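/- Let $L=\bigcup_{n\in\mathbb N}L_n$ be an alphabet, where $L_0\subseteq L_1\subseteq\cdots$ are finite sets, and let $v\notin L$ be a variable. Let $W_L$ be the set of words over $L$ and $W_{Lv}$ the set of variable words, i.e. words over $L\cup\{v\}$ in which $v$ occurs. A sequence $(x_n)_{n\in\mathbb N}$ of words is rapidly increasing if $|x_n|>\sum_{i<n}|x_i|$ for all $n$. Let $W_L^{[\infty]}$ and $W_{Lv}^{[\infty]}$ be the sets of infinite rapidly increasing sequences in $W_L$ and in $W_{Lv}$, and let $r_n$, $s_n$ be the maps sending a sequence in $W_L^{[\infty]}$, respectively $W_{Lv}^{[\infty]}$, to its first $n$ terms. Put $\mathcal{AR}=\{r_n(A): A\in W_L^{[\infty]},\,n\in\mathbb N\}$. For a finite or infinite sequence $X=(x_n)$ of variable words, let $[X]_L$ (respectively $[X]_{Lv}$) be the set of all $w\in W_L$ (respectively $w\in W_{Lv}$) of the form $w=x_{n_0}[\lambda_0]^\frown\cdots^\frown x_{n_k}[\lambda_k]$ with $k\ge 0$, $n_0<\dots<n_k$ and $\lambda_i\in L_{n_i}$ (respectively $\lambda_i\in L_{n_i}\cup\{v\}$),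 where $x[\lambda]$ is $x$ with every occurrence of $v$ replaced by $\lambda$; the set $\{n_0,\dots,n_k\}$ is the support of $w$ in $X$ (it is unique when $X$ is rapidly increasing). For $X,Y\in W_{Lv}^{[\infty]}$ and $A\in W_L^{[\infty]}$ write $X\le Y$ (respectively $A\le^0Y$) if all terms of $X$ lie in $[Y]_{Lv}$ (respectively all terms of $A$ lie in $[Y]_L$) and, for $n<m$, every element of the support of the $n$-th term in $Y$ is smaller than every element of the support of the $m$-th term. For $a\in\mathcal{AR}$ and a finite sequence $x$ of variable words, $a\le^0_{fin}x$ is defined in the same way. Put $$[a,Y]=\{A\in W_L^{[\infty]}: A\le^0Y,\ \exists n\ r_n(A)=a\},\qquad [d,Y]=\{X\in W_{Lv}^{[\infty]}: X\le Y,\ \exists n\ s_n(X)=s_d(Y)\}\quad(d\in\mathbb N),$$ and let $\mathrm{depth}_Y(a)=\min\{k: a\le^0_{fin}s_k(Y)\}$ (and $-1$ if there is no such $k$, which does not happen when $[a,Y]\ne\emptyset$). A set $\Lambda\subseteq 2^\infty\times W_L^{[\infty]}$ is perfectly $W_{Lv}^{[\infty]}$-Ramsey if for every nonempty perfect set $Q\subseteq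 2^\infty$, every $a\in\mathcal{AR}$ and every $Y\in W_{Lv}^{[\infty]}$ with $[a,Y]\neq\emptyset$, there are a nonempty perfect set $M\subseteq Q$ and $X\in[\mathrm{depth}_Y(a),Y]$ with $[a,X]\ne\emptyset$ such that $M\times[a,X]\subseteq\Lambda$ or $M\times[a,X]\subseteq\Lambda^c$. Then the perfectly $W_{Lv}^{[\infty]}$-Ramsey subsets of $2^\infty\times W_L^{[\infty]}$ form a field of sets (they include $\emptyset$ and are closed under complements and finite unions), and this field is closed under the Souslin operation: if $\Lambda_a$ is perfectly $W_{Lv}^{[\infty]}$-Ramsey for every $a\in\mathcal{AR}$, then so is $$\bigcup_{A\in W_L^{[\infty]}}\ \bigcap_{n\in\mathbb N}\Lambda_{r_n(A)}.$$ -/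

import Mathlib

namespace HJ

/-- A sequence of words is rapidly increasing if each word is longer than the concatenation of
all the earlier ones (in particular, all its words are nonempty). -/
def RapidlyIncreasing {α : Type*} (x : ℕ → List α) : Prop :=
  ∀ n, ∑ i ∈ Finset.range n, (x i).length < (x n).length

/-- Infinite rapidly increasing sequences of words over the alphabet `L`. -/
def WordSeq (L : Type*) : Type _ :=
  {A : ℕ → List L // RapidlyIncreasing A}

/-- Infinite rapidly increasing sequences of variable words over `L`. The letters are elements of
`Option L`, where `none` is the variable; a variable word is a word in which the variable
occurs. -/
def VarWordSeq (L : Type*) : Type _ :=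
  {X : ℕ → List (Option L) // (∀ n, none ∈ X n) ∧ RapidlyIncreasing X}

/-- The evaluation of the variable word `x` at the letter or variable `c`: every occurrence of
the variable is replaced by `c`. -/
def subst {L : Type*} (x : List (Option L)) (c : Option L) : List (Option L) :=
  x.map fun d => d.or c

/-- The concatenation of the words `x n` evaluated at `c n`, for `n` in `F` in increasing
order. -/
def comb {L : Type*} (x : ℕ → List (Option L)) (F : Finset ℕ) (c : ℕ → Option L) :
    List (Option L) :=
  (F.sort (· ≤ ·)).flatMap fun n => subst (x n) (c n)

/-- The word `w` over `L` belongs to the combinatorial subspace `[x]_L`, with support `F`. -/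
def HasSuppL {L : Type*} (Ls : ℕ → Finset L) (x : ℕ → List (Option L)) (F : Finset ℕ)
    (w : List L) : Prop :=
  F.Nonempty ∧ ∃ c : ℕ → L, (∀ n ∈ F, c n ∈ Ls n) ∧
    w.map some = comb x F (fun n => some (c n))

/-- The variable word `w` over `L` belongs to the combinatorial subspace `[x]_{Lv}`, with
support `F`. -/
def HasSuppLv {L : Type*} (Ls : ℕ → Finset L) (x : ℕ → List (Option L)) (F : Finset ℕ)
    (w : List (Option L)) : Prop :=
  F.Nonempty ∧ none ∈ w ∧ ∃ c : ℕ → Option L, (∀ n ∈ F, ∀ l, c n = some l → l ∈ Ls n) ∧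
    w = comb x F c

/-- `X ≤ Y`: the sequence `X` of variable words is a block subsequence of `Y`. -/
def VarLE {L : Type*} (Ls : ℕ → Finset L) (X Y : VarWordSeq L) : Prop :=
  ∃ F : ℕ → Finset ℕ, (∀ n, HasSuppLv Ls Y.1 (F n) (X.1 n)) ∧
    ∀ n m, n < m → ∀ p ∈ F n, ∀ q ∈ F m, p < q

/-- `A ≤⁰ Y`: the sequence `A` of words is a block subsequence of `Y`. -/
def WordLE {L : Type*} (Ls : ℕ → Finset L) (A : WordSeq L) (Y : VarWordSeq L) : Prop :=
  ∃ F : ℕ → Finset ℕ, (∀ n, HasSuppL Ls Y.1 (F n) (A.1 n)) ∧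
    ∀ n m, n < m → ∀ p ∈ F n, ∀ q ∈ F m, p < q

/-- The finite approximation `r_n(A)`, consisting of the first `n` words of `A`. -/
def r {L : Type*} (n : ℕ) (A : WordSeq L) : List (List L) :=
  (List.range n).map A.1

/-- The finite approximation `s_n(X)`, consisting of the first `n` variable words of `X`. -/
def s {L : Type*} (n : ℕ) (X : VarWordSeq L) : List (List (Option L)) :=
  (List.range n).map X.1

/-- The set of all finite approximations of sequences of words. -/
def AR (L : Type*) : Set (List (List L)) :=
  {a | ∃ (A : WordSeq L) (n : ℕ), r n A = a}

/-- The finitization of `≤⁰`: the finite sequence `a` of words is a block subsequence of the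
finite sequence `x` of variable words. -/
def FinWordLE {L : Type*} (Ls : ℕ → Finset L) (a : List (List L))
    (x : List (List (Option L))) : Prop :=
  ∃ F : ℕ → Finset ℕ,
    (∀ i (hi : i < a.length),
      F i ⊆ Finset.range x.length ∧ HasSuppL Ls (fun n => x.getD n []) (F i) a[i]) ∧
    ∀ i j, i < j → j < a.length → ∀ p ∈ F i, ∀ q ∈ F j, p < q

open Classical in
/-- The depth of `a` in `Y`. -/
noncomputable def depth {L : Type*} (Ls : ℕ → Finset L) (Y : VarWordSeq L)
    (a : List (List L)) : ℤ :=
  if h : ∃ k, FinWordLE Ls a (s k Y) then ((Nat.find h : ℕ) : ℤ) else -1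

/-- The basic set `[a, Y]` of sequences of words. -/
def basic {L : Type*} (Ls : ℕ → Finset L) (a : List (List L)) (Y : VarWordSeq L) :
    Set (WordSeq L) :=
  {A | WordLE Ls A Y ∧ ∃ n, r n A = a}

/-- The basic set `[x, Y]` of sequences of variable words. -/
def basicVar {L : Type*} (Ls : ℕ → Finset L) (x : List (List (Option L))) (Y : VarWordSeq L) :
    Set (VarWordSeq L) :=
  {X | VarLE Ls X Y ∧ ∃ n, s n X = x}

/-- The set `[depth_Y(a), Y]`, where `[d, Y] = [s_d(Y), Y]` for a natural number `d`; it is empty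
if the depth is `-1`, which does not happen when `[a, Y]` is nonempty. -/
def depthNhd {L : Type*} (Ls : ℕ → Finset L) (a : List (List L)) (Y : VarWordSeq L) :
    Set (VarWordSeq L) :=
  {X | ∃ d : ℕ, (d : ℤ) = depth Ls Y a ∧ X ∈ basicVar Ls (s d Y) Y}

/-- The family of (nonempty) perfect subsets of the Cantor space. -/
def PerfectSets : Set (Set (ℕ → Bool)) :=
  {Q | Perfect Q ∧ Q.Nonempty}

/-- Perfectly Ramsey subsets of the product of the Cantor space and the space of rapidly
increasing sequences of words. -/
def IsPerfectlyRamsey {L : Type*} (Ls : ℕ → Finset L) (Lam : Set ((ℕ → Bool) × WordSeq L)) :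
    Prop :=
  ∀ Q ∈ PerfectSets, ∀ a ∈ AR L, ∀ Y : VarWordSeq L, (basic Ls a Y).Nonempty →
    ∃ M ∈ PerfectSets, M ⊆ Q ∧ ∃ X ∈ depthNhd Ls a Y, (basic Ls a X).Nonempty ∧
      (M ×ˢ basic Ls a X ⊆ Lam ∨ M ×ˢ basic Ls a X ⊆ Lamᶜ)

/-- The Souslin operation applied to a family of sets indexed by finite approximations. -/
def souslin {L : Type*} {β : Type*} (Lam : List (List L) → Set β) : Set β :=
  ⋃ A : WordSeq L, ⋂ n : ℕ, Lam (r n A)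

end HJ

namespace HJ
-- Every word of a combinatorial subspace is the value of a located word, a list of pairs (index,
-- letter) with increasing indices. Substituting located words into located words (`bind`) makes the
-- block relation transitive; a letter allowed at index `n` stays allowed at all later indices
-- because the alphabets increase. The set `nbhd b j X` of sequences that begin with `b` and
-- continue with words located at `j` or later is easier to refine than `[b, X]`. In these terms a
-- set is perfectly Ramsey exactly when it is `RamBelow` every pair `(M, X)`
-- (`isPerfectlyRamsey_iff`), and the theorem becomes one about pairs of a perfect set and a
-- sequence of variable words, in the style of Ellentuck.
--
-- Two tools drive it. The first is the parametrized `pigeonhole`: if the colour of a word depends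
-- on a point of a perfect set and is locally constant in that point, then the perfect set and the
-- sequence can be refined so that a single colour remains. It rests on an idempotent ultrafilter
-- `p` on located words without variable, and an ultrafilter `q` on located variable words that
-- every substitution of a letter maps to `p`. Each point of the perfect set prefers one colour
-- `p`-almost everywhere, and one colour is preferred by uncountably many points. A common
-- homogeneous sequence is built for a dense-in-itself set of such points, and local constancy
-- carries the colour to its closure. The second tool is `fusion`: hereditary dense requirements,
-- countably many for each finite approximation, are met by one pair, locally in the perfect set.
--
-- Combinatorial forcing (a pair accepts, rejects or decides an approximation) then shows that open
-- sets are Ramsey (`exists_ext_of_open`). Countable unions follow, because fusion makes them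
-- relatively open. For the Souslin operation, each set of branches through `c` gets a Ramsey hull
-- `Ψ c`. What `Ψ c` contains beyond the hulls of the successors of `c` is negligible, fusion
-- removes all these remainders together, and outside them a point of `Ψ []` can be followed along
-- an infinite branch.
variable {L : Type*}

/-! ### Located words and block sequences -/

/-- The value of a located word `t` in the sequence `y`. -/
def ev (y : ℕ → List (Option L)) (t : List (ℕ × Option L)) : List (Option L) :=
  t.flatMap fun p => subst (y p.1) p.2

/-- Located words: their positions are strictly increasing, at least `m`, and the letter at
position `n` belongs to `Ls n` or is the variable. -/
def Loc (Ls : ℕ → Finset L) (m : ℕ) (t : List (ℕ × Option L)) : Prop :=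
  t ≠ [] ∧ t.Pairwise (fun p q => p.1 < q.1) ∧
    ∀ p ∈ t, m ≤ p.1 ∧ ∀ l, p.2 = some l → l ∈ Ls p.1

/-- The sequence `u` is a block sequence of values of located words in the sequence `y`, all of
them located at `m` or later. -/
def Blk (Ls : ℕ → Finset L) (y : ℕ → List (Option L)) (m : ℕ) (u : ℕ → List (Option L)) :
    Prop :=
  ∃ τ : ℕ → List (ℕ × Option L), (∀ n, Loc Ls m (τ n) ∧ u n = ev y (τ n)) ∧
    ∀ n k, n < k → ∀ p ∈ τ n, ∀ q ∈ τ k, p.1 < q.1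

/-- The finite sequence `b` is a block sequence of values of words located before `m`. -/
def FBlk (Ls : ℕ → Finset L) (y : ℕ → List (Option L)) (m : ℕ) (b : List (List L)) : Prop :=
  ∃ τ : ℕ → List (ℕ × Option L),
    (∀ i (hi : i < b.length),
      Loc Ls 0 (τ i) ∧ (∀ p ∈ τ i, p.1 < m) ∧ b[i].map some = ev y (τ i)) ∧
    ∀ i j, i < j → j < b.length → ∀ p ∈ τ i, ∀ q ∈ τ j, p.1 < q.1

/-- The sequences extending `b` by a block sequence in `X` located at `m` or later. -/
def nbhd (Ls : ℕ → Finset L) (b : List (List L)) (m : ℕ) (X : VarWordSeq L) :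
    Set (WordSeq L) :=
  {A | r b.length A = b ∧ Blk Ls X.1 m (fun i => (A.1 (b.length + i)).map some)}

/-- `X` is a block subsequence of `Y` with the same first `m` terms. -/
def Ext (Ls : ℕ → Finset L) (m : ℕ) (X Y : VarWordSeq L) : Prop :=
  Blk Ls Y.1 0 X.1 ∧ ∀ n < m, X.1 n = Y.1 n

theorem ev_append (y : ℕ → List (Option L)) (t t' : List (ℕ × Option L)) :
    ev y (t ++ t') = ev y t ++ ev y t' := by
  simp [ev]

theorem ev_singleton (y : ℕ → List (Option L)) (p : ℕ × Option L) :
    ev y [p] = subst (y p.1) p.2 := by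
  simp [ev]

theorem subst_none (x : List (Option L)) : subst x none = x := by
  simp [subst]

theorem subst_ev (y : ℕ → List (Option L)) (t : List (ℕ × Option L)) (c : Option L) :
    subst (ev y t) c = ev y (t.map fun p => (p.1, p.2.or c)) := by
  simp only [subst, ev, List.map_flatMap, List.flatMap_map, List.map_map]
  congr 1
  funext p
  congr 1
  funext d
  simp [Option.or_assoc]

theorem ev_congr {y z : ℕ → List (Option L)} {t : List (ℕ × Option L)}
    (h : ∀ p ∈ t, y p.1 = z p.1) : ev y t = ev z t := by
  induction t with
  | nil => rfl
  | cons p t ih =>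
    rw [← List.singleton_append, ev_append, ev_append, ev_singleton, ev_singleton,
      h p (by simp), ih fun q hq => h q (by simp [hq])]

/-- Substitution of located words into a located word. -/
def bind (τ : ℕ → List (ℕ × Option L)) (t : List (ℕ × Option L)) : List (ℕ × Option L) :=
  t.flatMap fun p => (τ p.1).map fun q => (q.1, q.2.or p.2)

theorem ev_bind {y z : ℕ → List (Option L)} {τ : ℕ → List (ℕ × Option L)}
    {t : List (ℕ × Option L)} (h : ∀ p ∈ t, z p.1 = ev y (τ p.1)) :
    ev z t = ev y (bind τ t) := by
  induction t with
  | nil => rfl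
  | cons p t ih =>
    rw [← List.singleton_append, ev_append, ev_singleton, ih fun q hq => h q (by simp [hq]),
      h p (by simp), subst_ev]
    simp [bind, ev_append]

theorem mem_bind {τ : ℕ → List (ℕ × Option L)} {t : List (ℕ × Option L)} {q : ℕ × Option L} :
    q ∈ bind τ t ↔ ∃ p ∈ t, ∃ q' ∈ τ p.1, q = (q'.1, q'.2.or p.2) := by
  simp only [bind, List.mem_flatMap, List.mem_map]
  aesop

theorem Loc.mono {Ls : ℕ → Finset L} {m k : ℕ} {t : List (ℕ × Option L)} (h : Loc Ls m t)
    (hk : k ≤ m) : Loc Ls k t :=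
  ⟨h.1, h.2.1, fun p hp => ⟨hk.trans (h.2.2 p hp).1, (h.2.2 p hp).2⟩⟩

theorem le_of_block {τ : ℕ → List (ℕ × Option L)} (hne : ∀ n, τ n ≠ [])
    (hb : ∀ n k, n < k → ∀ p ∈ τ n, ∀ q ∈ τ k, p.1 < q.1) (n : ℕ) :
    ∀ p ∈ τ n, n ≤ p.1 := by
  induction n with
  | zero => intro p _; exact Nat.zero_le _
  | succ n ih =>
    intro p hp
    obtain ⟨q, hq⟩ := List.exists_mem_of_ne_nil _ (hne n)
    exact (ih q hq).trans_lt (hb n (n + 1) (Nat.lt_succ_self n) q hq p hp)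

/-- Blocks move indices only to the right (`le_of_block`), so a letter allowed at the old index is
allowed at the new one by monotonicity of `Ls`. -/
theorem Loc.bind {Ls : ℕ → Finset L} (hmono : Monotone Ls) {τ : ℕ → List (ℕ × Option L)}
    {m : ℕ} {t : List (ℕ × Option L)} (ht : Loc Ls m t) (hτ : ∀ n, Loc Ls 0 (τ n))
    (hb : ∀ n k, n < k → ∀ p ∈ τ n, ∀ q ∈ τ k, p.1 < q.1) : Loc Ls m (bind τ t) := by
  have hle := le_of_block (fun n => (hτ n).1) hb
  refine ⟨?_, ?_, ?_⟩
  · obtain ⟨p, hp⟩ := List.exists_mem_of_ne_nil _ ht.1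
    obtain ⟨q, hq⟩ := List.exists_mem_of_ne_nil _ (hτ p.1).1
    exact List.ne_nil_of_mem (mem_bind.2 ⟨p, hp, q, hq, rfl⟩)
  · rw [HJ.bind, List.pairwise_flatMap]
    refine ⟨fun p _ => ?_, ?_⟩
    · rw [List.pairwise_map]
      exact (hτ p.1).2.1
    · refine ht.2.1.imp ?_
      intro p q hpq u hu v hv
      simp only [List.mem_map] at hu hv
      obtain ⟨u', hu', rfl⟩ := hu
      obtain ⟨v', hv', rfl⟩ := hv
      exact hb _ _ hpq u' hu' v' hv'
  · intro q hq
    obtain ⟨p, hp, q', hq', rfl⟩ := mem_bind.1 hq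
    refine ⟨(ht.2.2 p hp).1.trans (hle _ q' hq'), fun l hl => ?_⟩
    rcases Option.or_eq_some_iff.1 hl with h | h
    · exact ((hτ p.1).2.2 q' hq').2 l h
    · exact hmono (hle _ q' hq') ((ht.2.2 p hp).2 l h.2)

theorem bind_lt {τ : ℕ → List (ℕ × Option L)}
    (hb : ∀ n k, n < k → ∀ p ∈ τ n, ∀ q ∈ τ k, p.1 < q.1) {t t' : List (ℕ × Option L)}
    (h : ∀ p ∈ t, ∀ q ∈ t', p.1 < q.1) : ∀ p ∈ bind τ t, ∀ q ∈ bind τ t', p.1 < q.1 := by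
  intro p hp q hq
  obtain ⟨p1, hp1, p2, hp2, rfl⟩ := mem_bind.1 hp
  obtain ⟨q1, hq1, q2, hq2, rfl⟩ := mem_bind.1 hq
  exact hb _ _ (h p1 hp1 q1 hq1) p2 hp2 q2 hq2

theorem Blk.trans {Ls : ℕ → Finset L} (hmono : Monotone Ls) {x y u : ℕ → List (Option L)}
    {m : ℕ} (hu : Blk Ls x m u) (hx : Blk Ls y 0 x) : Blk Ls y m u := by
  obtain ⟨σ, hσ, hσb⟩ := hu
  obtain ⟨τ, hτ, hτb⟩ := hx
  refine ⟨fun n => bind τ (σ n), fun n => ⟨(hσ n).1.bind hmono (fun n => (hτ n).1) hτb, ?_⟩, ?_⟩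
  · rw [(hσ n).2]
    exact ev_bind fun p _ => (hτ p.1).2
  · exact fun n k hnk => bind_lt hτb (hσb n k hnk)

theorem loc_singleton {Ls : ℕ → Finset L} {m n : ℕ} (h : m ≤ n) :
    Loc Ls m [((n : ℕ), (none : Option L))] := by
  simp [Loc, h]

theorem Blk.refl (Ls : ℕ → Finset L) (y : ℕ → List (Option L)) : Blk Ls y 0 y :=
  ⟨fun n => [(n, none)], fun n => ⟨loc_singleton (Nat.zero_le _), by
    rw [ev_singleton, subst_none]⟩, by simp⟩

/-- Only the terms from the `m`-th on matter for `Blk Ls y m`; a tail may be shifted. -/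
theorem Blk.shift {Ls : ℕ → Finset L} (hmono : Monotone Ls) {y z u : ℕ → List (Option L)}
    {m k d : ℕ} (h : Blk Ls y m u) (hk : k ≤ m + d) (hz : ∀ n, m ≤ n → y n = z (n + d)) :
    Blk Ls z k u := by
  obtain ⟨τ, hτ, hb⟩ := h
  refine ⟨fun n => (τ n).map fun p => (p.1 + d, p.2), fun n => ⟨⟨?_, ?_, ?_⟩, ?_⟩, ?_⟩
  · simpa using (hτ n).1.1
  · rw [List.pairwise_map]
    exact (hτ n).1.2.1.imp fun h => by simpa using h
  · intro p hp
    obtain ⟨q, hq, rfl⟩ := List.mem_map.1 hp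
    obtain ⟨h1, h2⟩ := (hτ n).1.2.2 q hq
    exact ⟨by dsimp; omega, fun l hl => hmono (Nat.le_add_right _ _) (h2 l hl)⟩
  · rw [(hτ n).2]
    simp only [ev, List.flatMap_map]
    exact List.flatMap_congr fun p hp => by rw [hz _ ((hτ n).1.2.2 p hp).1]
  · intro n k hnk p hp q hq
    obtain ⟨p', hp', rfl⟩ := List.mem_map.1 hp
    obtain ⟨q', hq', rfl⟩ := List.mem_map.1 hq
    simpa using hb n k hnk p' hp' q' hq'

/-! ### Lengths and rapid increase -/

theorem length_ev (y : ℕ → List (Option L)) (t : List (ℕ × Option L)) :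
    (ev y t).length = (t.map fun p => (y p.1).length).sum := by
  simp [ev, List.length_flatMap, subst]

theorem length_ev_le (y : ℕ → List (Option L)) {t : List (ℕ × Option L)} {k : ℕ}
    (ht : t.Pairwise fun p q => p.1 < q.1) (hk : ∀ p ∈ t, p.1 < k) :
    (ev y t).length ≤ ∑ i ∈ Finset.range k, (y i).length := by
  have hnd : (t.map Prod.fst).Nodup := by
    rw [List.nodup_iff_pairwise_ne, List.pairwise_map]
    exact ht.imp fun h => h.ne
  rw [length_ev, show (t.map fun p => (y p.1).length) =
    (t.map Prod.fst).map fun i => (y i).length by simp,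
    ← List.sum_toFinset _ hnd]
  refine Finset.sum_le_sum_of_subset fun i hi => ?_
  simp only [List.mem_toFinset, List.mem_map] at hi
  obtain ⟨p, hp, rfl⟩ := hi
  exact Finset.mem_range.2 (hk p hp)

/-- The concatenation of the first `n` terms is the value of a word located before any index `p`
used by the `n`-th term. Each index is used at most once, so its length is at most the sum of the
lengths of the `y i` with `i < p`, hence less than the length of `y p`. -/
theorem Blk.rapidlyIncreasing {Ls : ℕ → Finset L} {y u : ℕ → List (Option L)}
    (h : Blk Ls y 0 u) (hy : RapidlyIncreasing y) : RapidlyIncreasing u := by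
  obtain ⟨τ, hτ, hb⟩ := h
  intro n
  obtain ⟨p, hp⟩ := List.exists_mem_of_ne_nil _ (hτ n).1.1
  have h1 : (y p.1).length ≤ (u n).length := by
    rw [(hτ n).2, length_ev]
    exact List.single_le_sum (by simp) _ (List.mem_map.2 ⟨p, hp, rfl⟩)
  have h2 : ∑ i ∈ Finset.range n, (u i).length =
      (ev y ((List.range n).flatMap τ)).length := by
    clear h1 hp
    induction n with
    | zero => simp [ev]
    | succ n ih =>
      rw [Finset.sum_range_succ, ih, List.range_succ, List.flatMap_append, ev_append,
        List.length_append, (hτ n).2]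
      simp
  rw [h2]
  refine lt_of_le_of_lt (length_ev_le y ?_ ?_) ((hy p.1).trans_le h1)
  · rw [List.pairwise_flatMap]
    refine ⟨fun i _ => (hτ i).1.2.1, ?_⟩
    exact List.pairwise_lt_range.imp fun {i j} hij u hu v hv => hb i j hij u hu v hv
  · intro q hq
    obtain ⟨i, hi, hq⟩ := List.mem_flatMap.1 hq
    exact hb i n (List.mem_range.1 hi) q hq p hp

/-! ### Refinements that fix initial terms, and their limits -/

theorem Ext.refl (Ls : ℕ → Finset L) (m : ℕ) (X : VarWordSeq L) : Ext Ls m X X :=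
  ⟨Blk.refl _ _, fun _ _ => rfl⟩

theorem Ext.trans {Ls : ℕ → Finset L} (hmono : Monotone Ls) {m k : ℕ} {X Y Z : VarWordSeq L}
    (h : Ext Ls m X Y) (h' : Ext Ls k Y Z) (hkm : k ≤ m) : Ext Ls k X Z :=
  ⟨h.1.trans hmono h'.1, fun n hn => (h.2 n (by omega)).trans (h'.2 n hn)⟩

/-- Each fixed term can be located at itself; the remaining words stay to the right by
`le_of_block`. Trivial locations make compositions of refinements stabilize in a fusion limit. -/
theorem Ext.exists_loc {Ls : ℕ → Finset L} {m : ℕ} {X Y : VarWordSeq L} (h : Ext Ls m X Y) :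
    ∃ τ : ℕ → List (ℕ × Option L), (∀ n, Loc Ls 0 (τ n) ∧ X.1 n = ev Y.1 (τ n)) ∧
      (∀ n k, n < k → ∀ p ∈ τ n, ∀ q ∈ τ k, p.1 < q.1) ∧ ∀ n < m, τ n = [(n, none)] := by
  obtain ⟨⟨τ, hτ, hb⟩, hm⟩ := h
  have hle := le_of_block (fun n => (hτ n).1.1) hb
  refine ⟨fun n => if n < m then [(n, none)] else τ n, fun n => ?_, ?_, fun n hn => by simp [hn]⟩
  · by_cases hn : n < m
    · simp only [hn, if_true]
      exact ⟨loc_singleton (Nat.zero_le _), by rw [ev_singleton, subst_none, hm n hn]⟩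
    · simpa only [hn, if_false] using hτ n
  · intro n k hnk p hp q hq
    dsimp only at hp hq
    split_ifs at hp hq with h1 h2 h2
    · simp only [List.mem_singleton] at hp hq
      subst hp hq
      exact hnk
    · simp only [List.mem_singleton] at hp
      subst hp
      exact hnk.trans_le (hle k q hq)
    · omega
    · exact hb n k hnk p hp q hq

/-- Replacing the terms of `Y` from the `m`-th on by a tail of `X ≤ Y`. -/
theorem exists_ext_tail {Ls : ℕ → Finset L} {X Y : VarWordSeq L}
    (h : Blk Ls Y.1 0 X.1) (m d : ℕ) :
    ∃ Z : VarWordSeq L, Ext Ls m Z Y ∧ ∀ n, m ≤ n → Z.1 n = X.1 (n + d) := by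
  obtain ⟨τ, hτ, hb⟩ := h
  have hle := le_of_block (fun n => (hτ n).1.1) hb
  have key : Blk Ls Y.1 0 (fun n => if n < m then Y.1 n else X.1 (n + d)) := by
    refine ⟨fun n => if n < m then [(n, none)] else τ (n + d), fun n => ?_, ?_⟩
    · by_cases hn : n < m
      · simp only [hn, if_true]
        exact ⟨loc_singleton (Nat.zero_le _), by rw [ev_singleton, subst_none]⟩
      · simpa only [hn, if_false] using hτ (n + d)
    · intro n k hnk p hp q hq
      dsimp only at hp hq
      split_ifs at hp hq with h1 h2 h2
      · simp only [List.mem_singleton] at hp hq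
        subst hp hq
        exact hnk
      · simp only [List.mem_singleton] at hp
        subst hp
        have := hle _ q hq
        dsimp only
        omega
      · omega
      · exact hb _ _ (by omega) p hp q hq
  refine ⟨⟨_, fun n => ?_, key.rapidlyIncreasing Y.2.2⟩, ⟨key, fun n hn => by simp [hn]⟩,
    fun n hn => by simp [Nat.not_lt.2 hn]⟩
  split_ifs
  · exact Y.2.1 n
  · exact X.2.1 _

theorem nbhd_mono {Ls : ℕ → Finset L} (hmono : Monotone Ls) {X Y : VarWordSeq L}
    (h : Blk Ls Y.1 0 X.1) (b : List (List L)) (m : ℕ) : nbhd Ls b m X ⊆ nbhd Ls b m Y :=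
  fun _ hA => ⟨hA.1, hA.2.trans hmono h⟩

theorem nbhd_shift {Ls : ℕ → Finset L} (hmono : Monotone Ls) {X Z : VarWordSeq L} {m k d : ℕ}
    (hz : ∀ n, m ≤ n → Z.1 n = X.1 (n + d)) (hk : k ≤ m + d) (b : List (List L)) :
    nbhd Ls b m Z ⊆ nbhd Ls b k X :=
  fun _ hA => ⟨hA.1, hA.2.shift hmono hk hz⟩

/-- An arbitrary refinement `X` is traded for one that keeps the first `m` terms of `Y`: afterwards
`Z` follows `X` from index `m + (k - m)` on, which is at least `k` by truncated subtraction. -/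
theorem exists_ext_nbhd {Ls : ℕ → Finset L} (hmono : Monotone Ls) {X Y : VarWordSeq L}
    (h : Blk Ls Y.1 0 X.1) (m k : ℕ) :
    ∃ Z : VarWordSeq L, Ext Ls m Z Y ∧ ∀ b, nbhd Ls b m Z ⊆ nbhd Ls b k X := by
  obtain ⟨Z, hZ, hz⟩ := exists_ext_tail h m (k - m)
  exact ⟨Z, hZ, fun b => nbhd_shift hmono hz (by omega) b⟩

/-- The limit of a fusion sequence. -/
theorem exists_fusion_limit {Ls : ℕ → Finset L} (hmono : Monotone Ls) {m : ℕ}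
    (X : ℕ → VarWordSeq L) (h : ∀ k, Ext Ls (m + k) (X (k + 1)) (X k)) :
    ∃ Z : VarWordSeq L, ∀ k, Ext Ls (m + k) Z (X k) := by
  have stab : ∀ k j n, n < m + k → (X (k + j)).1 n = (X k).1 n := by
    intro k j n hn
    induction j with
    | zero => rfl
    | succ j ih => rw [← ih]; exact (h (k + j)).2 n (by omega)
  have stab' : ∀ k n, n < m + k → (X (n + 1)).1 n = (X k).1 n := by
    intro k n hn
    rcases le_total k (n + 1) with hk | hk
    · obtain ⟨j, hj⟩ := Nat.exists_eq_add_of_le hk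
      rw [hj]
      exact stab k j n hn
    · obtain ⟨j, hj⟩ := Nat.exists_eq_add_of_le hk
      rw [hj]
      exact (stab (n + 1) j n (by omega)).symm
  have key : ∀ k, Blk Ls (X k).1 0 (fun n => (X (n + 1)).1 n) := by
    intro k
    choose τ hτ hτb hτm using fun j => (h (k + j)).exists_loc
    -- `ρ j n` locates the `n`-th term of `X (k + j)` in `X k`, by composing the one-step locations.
    let ρ : ℕ → ℕ → List (ℕ × Option L) := fun j =>
      Nat.rec (fun n => [(n, none)]) (fun j ρ n => bind ρ (τ j n)) j
    have hρs : ∀ j n, ρ (j + 1) n = bind (ρ j) (τ j n) := fun j n => rfl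
    have hρ : ∀ j, (∀ n, Loc Ls 0 (ρ j n) ∧ (X (k + j)).1 n = ev (X k).1 (ρ j n)) ∧
        (∀ n i, n < i → ∀ p ∈ ρ j n, ∀ q ∈ ρ j i, p.1 < q.1) := by
      intro j
      induction j with
      | zero =>
        refine ⟨fun n => ⟨loc_singleton (Nat.zero_le _), ?_⟩, by simp [ρ]⟩
        simp [ρ, ev_singleton, subst_none]
      | succ j ih =>
        refine ⟨fun n => ⟨?_, ?_⟩, fun n i hni => ?_⟩
        · exact (hτ j n).1.bind hmono (fun n => (ih.1 n).1) ih.2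
        · rw [hρs, ← ev_bind (z := (X (k + j)).1) fun p _ => (ih.1 p.1).2]
          exact (hτ j n).2
        · exact bind_lt ih.2 (hτb j n i hni)
    have hρst : ∀ j n i, n < m + (k + j) → ρ (j + i) n = ρ j n := by
      intro j n i hn
      induction i with
      | zero => rfl
      | succ i ih =>
        rw [← ih, ← add_assoc, hρs, hτm (j + i) n (by omega)]
        simp [bind]
    -- Diagonal choice: by `hρst`, the location of the `n`-th term no longer changes from stage `n +
    -- 1` on, so any two terms can be compared at a common stage.
    refine ⟨fun n => ρ (n + 1) n, fun n => ⟨((hρ (n + 1)).1 n).1, ?_⟩, ?_⟩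
    · dsimp only
      rw [← ((hρ (n + 1)).1 n).2]
      exact stab' _ n (by omega)
    · intro n i hni
      dsimp only
      obtain ⟨d, rfl⟩ := Nat.exists_eq_add_of_lt hni
      rw [← hρst (n + 1) n (d + 1) (by omega), show n + 1 + (d + 1) = n + d + 1 + 1 by ring]
      exact (hρ (n + d + 1 + 1)).2 n (n + d + 1) hni
  exact ⟨⟨_, fun n => (X (n + 1)).2.1 n, (key 0).rapidlyIncreasing (X 0).2.2⟩,
    fun k => ⟨key k, fun n hn => stab' k n hn⟩⟩

/-! ### Finite approximations and their neighbourhoods -/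

theorem r_succ (n : ℕ) (A : WordSeq L) : r (n + 1) A = r n A ++ [A.1 n] := by
  simp [r, List.range_succ]

theorem length_r (n : ℕ) (A : WordSeq L) : (r n A).length = n := by
  simp [r]

theorem FBlk.congr {Ls : ℕ → Finset L} {x y : ℕ → List (Option L)} {m : ℕ}
    {b : List (List L)} (h : FBlk Ls x m b) (hxy : ∀ n < m, x n = y n) : FBlk Ls y m b := by
  obtain ⟨τ, hτ, hb⟩ := h
  refine ⟨τ, fun i hi => ⟨(hτ i hi).1, (hτ i hi).2.1, ?_⟩, hb⟩
  rw [(hτ i hi).2.2]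
  exact ev_congr fun p hp => hxy _ ((hτ i hi).2.1 p hp)

theorem FBlk.mono {Ls : ℕ → Finset L} {x : ℕ → List (Option L)} {m k : ℕ}
    {b : List (List L)} (h : FBlk Ls x m b) (hk : m ≤ k) : FBlk Ls x k b := by
  obtain ⟨τ, hτ, hb⟩ := h
  exact ⟨τ, fun i hi => ⟨(hτ i hi).1, fun p hp => ((hτ i hi).2.1 p hp).trans_le hk,
    (hτ i hi).2.2⟩, hb⟩

theorem exists_lt_of_list (t : List (ℕ × Option L)) (j : ℕ) : ∃ k, j ≤ k ∧ ∀ p ∈ t, p.1 < k := by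
  induction t with
  | nil => exact ⟨j, le_rfl, by simp⟩
  | cons p t ih =>
    obtain ⟨k, hk, h⟩ := ih
    refine ⟨max k (p.1 + 1), by omega, fun q hq => ?_⟩
    rcases List.mem_cons.1 hq with rfl | hq
    · omega
    · have := h q hq
      omega

/-- The cut at `m` in `x` is moved to the first index of the block of `y` that represents `x m`: it
separates the blocks before `m` from those at `m` or later. -/
theorem FBlk.trans {Ls : ℕ → Finset L} (hmono : Monotone Ls) {x y : ℕ → List (Option L)} {m : ℕ}
    {b : List (List L)} (h : FBlk Ls x m b) (hxy : Blk Ls y 0 x) :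
    ∃ k, m ≤ k ∧ FBlk Ls y k b ∧ ∀ u, Blk Ls x m u → Blk Ls y k u := by
  obtain ⟨τ, hτ, hb⟩ := h
  obtain ⟨σ, hσ, hσb⟩ := hxy
  obtain ⟨k, l, hkl⟩ := List.exists_cons_of_ne_nil (hσ m).1.1
  have hk : k ∈ σ m := by simp [hkl]
  refine ⟨k.1, le_of_block (fun n => (hσ n).1.1) hσb m k hk,
    ⟨fun i => bind σ (τ i), fun i hi => ⟨?_, ?_, ?_⟩, ?_⟩, ?_⟩
  · exact (hτ i hi).1.bind hmono (fun n => (hσ n).1) hσb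
  · intro p hp
    obtain ⟨q, hq, q', hq', rfl⟩ := mem_bind.1 hp
    exact hσb _ _ ((hτ i hi).2.1 q hq) q' hq' k hk
  · rw [(hτ i hi).2.2]
    exact ev_bind fun p _ => (hσ p.1).2
  · exact fun i j hij hj => bind_lt hσb (hb i j hij hj)
  · rintro u ⟨ρ, hρ, hρb⟩
    refine ⟨fun n => bind σ (ρ n), fun n => ⟨?_, ?_⟩, fun n i hni => bind_lt hσb (hρb n i hni)⟩
    · obtain ⟨h1, h2, h3⟩ := (hρ n).1.bind hmono (fun n => (hσ n).1) hσb
      refine ⟨h1, h2, fun p hp => ⟨?_, (h3 p hp).2⟩⟩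
      obtain ⟨q, hq, q', hq', rfl⟩ := mem_bind.1 hp
      rcases ((hρ n).1.2.2 q hq).1.eq_or_lt with hmq | hmq
      · rw [← hmq] at hq'
        have hs := (hσ m).1.2.1
        rw [hkl] at hs hq'
        rcases List.mem_cons.1 hq' with rfl | hq'
        · exact le_rfl
        · exact ((List.pairwise_cons.1 hs).1 q' hq').le
      · exact (hσb _ _ hmq k hk q' hq').le
    · rw [(hρ n).2]
      exact ev_bind fun p _ => (hσ p.1).2

theorem FBlk.append {Ls : ℕ → Finset L} {x : ℕ → List (Option L)} {m k : ℕ}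
    {b : List (List L)} (h : FBlk Ls x m b) {t : List (ℕ × Option L)} (ht : Loc Ls m t)
    (hk : ∀ p ∈ t, p.1 < k) {w : List L} (hw : w.map some = ev x t) :
    FBlk Ls x k (b ++ [w]) := by
  have hmk : m ≤ k := by
    obtain ⟨p, hp⟩ := List.exists_mem_of_ne_nil _ ht.1
    exact (ht.2.2 p hp).1.trans (hk p hp).le
  obtain ⟨τ, hτ, hb⟩ := h
  refine ⟨fun i => if i < b.length then τ i else t, fun i hi => ?_, ?_⟩
  · by_cases hib : i < b.length
    · simp only [hib, if_true, List.getElem_append_left]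
      exact ⟨(hτ i hib).1, fun p hp => ((hτ i hib).2.1 p hp).trans_le hmk, (hτ i hib).2.2⟩
    · simp only [hib, if_false]
      refine ⟨ht.mono (Nat.zero_le _), hk, ?_⟩
      rw [← hw, List.getElem_append_right (by omega)]
      simp
  · intro i j hij hj p hp q hq
    simp only [List.length_append, List.length_singleton] at hj
    have hib : i < b.length := by omega
    simp only [hib, if_true] at hp
    by_cases hjb : j < b.length
    · simp only [hjb, if_true] at hq
      exact hb i j hij hjb p hp q hq
    · simp only [hjb, if_false] at hq
      exact ((hτ i hib).2.1 p hp).trans_le (ht.2.2 q hq).1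

theorem nbhd_append_subset {Ls : ℕ → Finset L} {X : VarWordSeq L} {m k : ℕ}
    {b : List (List L)} {t : List (ℕ × Option L)} (ht : Loc Ls m t)
    (hk : ∀ p ∈ t, p.1 < k) {w : List L} (hw : w.map some = ev X.1 t) :
    nbhd Ls (b ++ [w]) k X ⊆ nbhd Ls b m X := by
  have hmk : m ≤ k := by
    obtain ⟨p, hp⟩ := List.exists_mem_of_ne_nil _ ht.1
    exact (ht.2.2 p hp).1.trans (hk p hp).le
  rintro A ⟨hr, τ, hτ, hb⟩
  rw [List.length_append, List.length_singleton, r_succ] at hr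
  obtain ⟨hr, hAw⟩ := List.append_inj' hr rfl
  simp only [List.cons.injEq, and_true] at hAw
  refine ⟨hr, fun i => Nat.casesOn i t τ, fun n => ?_, fun n j hnj p hp q hq => ?_⟩
  · cases n with
    | zero => exact ⟨ht, by simpa [hAw] using hw⟩
    | succ n =>
      refine ⟨(hτ n).1.mono hmk, ?_⟩
      dsimp only
      rw [← (hτ n).2]
      exact congrArg (fun i => (A.1 i).map some)
        (by simp only [List.length_append, List.length_singleton]; omega)
  · cases j with
    | zero => omega
    | succ j =>
      cases n with
      | zero => exact (hk p hp).trans_le ((hτ j).1.2.2 q hq).1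
      | succ n => exact hb n j (by omega) p hp q hq

theorem exists_step {Ls : ℕ → Finset L} {X : VarWordSeq L} {m : ℕ} {b : List (List L)}
    {A : WordSeq L} (hA : A ∈ nbhd Ls b m X) :
    ∃ k, m < k ∧ A ∈ nbhd Ls (b ++ [A.1 b.length]) k X ∧ ∃ t, Loc Ls m t ∧ (∀ p ∈ t, p.1 < k) ∧
      (A.1 b.length).map some = ev X.1 t := by
  obtain ⟨hr, τ, hτ, hb⟩ := hA
  obtain ⟨q, hq⟩ := List.exists_mem_of_ne_nil _ (hτ 1).1.1
  -- The cut is the first index of the word after the next one; all later words lie at it or beyond.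
  have hmin : ∃ k, m < k ∧ (∀ p ∈ τ 0, p.1 < k) ∧ ∀ n, ∀ p ∈ τ (n + 1), k ≤ p.1 := by
    obtain ⟨k, hk⟩ : ∃ k, k = (τ 1).head (hτ 1).1.1 := ⟨_, rfl⟩
    have hk1 : k ∈ τ 1 := hk ▸ List.head_mem _
    obtain ⟨p, hp⟩ := List.exists_mem_of_ne_nil _ (hτ 0).1.1
    refine ⟨k.1, ((hτ 0).1.2.2 p hp).1.trans_lt (hb 0 1 one_pos p hp k hk1),
      fun p hp => hb 0 1 one_pos p hp k hk1, fun n p hp => ?_⟩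
    cases n with
    | zero =>
      have h2 := (hτ 1).1.2.1
      obtain ⟨l, hl⟩ : ∃ l, τ 1 = k :: l := ⟨_, by rw [hk]; exact (List.cons_head_tail _).symm⟩
      rw [zero_add, hl] at hp
      rw [hl, List.pairwise_cons] at h2
      rcases List.mem_cons.1 hp with rfl | hp
      · exact le_rfl
      · exact (h2.1 p hp).le
    | succ n => exact (hb 1 _ (by omega) k hk1 p hp).le
  obtain ⟨k, hmk, hk0, hk⟩ := hmin
  refine ⟨k, hmk, ⟨?_, fun n => τ (n + 1), fun n => ⟨⟨(hτ _).1.1, (hτ _).1.2.1, fun p hp =>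
    ⟨hk n p hp, ((hτ _).1.2.2 p hp).2⟩⟩, ?_⟩, fun n j hnj => hb _ _ (by omega)⟩,
    τ 0, (hτ 0).1, hk0, (hτ 0).2⟩
  · rw [List.length_append, List.length_singleton, r_succ, hr]
  · rw [← (hτ (n + 1)).2]
    exact congrArg (fun i => (A.1 i).map some)
        (by simp only [List.length_append, List.length_singleton]; omega)

/-- Iterates `exists_step`. The bound `m + n ≤ k` matters: after fusion a requirement of index `i`
is met only at cuts `k ≥ i`, and passing to a longer approximation reaches such a cut. -/
theorem exists_split {Ls : ℕ → Finset L} {X : VarWordSeq L} {m : ℕ} {b : List (List L)}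
    {A : WordSeq L} (hA : A ∈ nbhd Ls b m X) (n : ℕ) :
    ∃ k, m + n ≤ k ∧ A ∈ nbhd Ls (r (b.length + n) A) k X ∧
      nbhd Ls (r (b.length + n) A) k X ⊆ nbhd Ls b m X ∧
      (FBlk Ls X.1 m b → FBlk Ls X.1 k (r (b.length + n) A)) := by
  induction n with
  | zero =>
    refine ⟨m, le_rfl, ?_⟩
    rw [add_zero, hA.1]
    exact ⟨hA, subset_rfl, id⟩
  | succ n ih =>
    obtain ⟨k, hk, hAk, hsub, hF⟩ := ih
    obtain ⟨k', hk', hA', t, ht, htk, hw⟩ := exists_step hAk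
    rw [length_r, ← r_succ] at hA'
    rw [length_r] at hw
    refine ⟨k', by omega, hA', ?_, fun h => ?_⟩
    · rw [← add_assoc, r_succ]
      exact (nbhd_append_subset ht htk hw).trans hsub
    · rw [← add_assoc, r_succ]
      exact (hF h).append ht htk hw

/-- Dependent choice. -/
theorem exists_seq_of_step {α : Type*} (I : ℕ → α → Prop) (R : ℕ → α → α → Prop)
    (a : α) (ha : I 0 a) (h : ∀ k x, I k x → ∃ y, I (k + 1) y ∧ R k x y) :
    ∃ f : ℕ → α, f 0 = a ∧ ∀ k, I k (f k) ∧ R k (f k) (f (k + 1)) := by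
  choose g hg using fun k (x : {x // I k x}) => h k x.1 x.2
  let F : (k : ℕ) → {x // I k x} := fun k =>
    Nat.rec ⟨a, ha⟩ (fun k x => ⟨g k x, (hg k x).1⟩) k
  exact ⟨fun k => (F k).1, rfl, fun k => ⟨(F k).2, (hg k (F k)).2⟩⟩

/-! ### Perfect subsets of the Cantor space -/

/-- The basic clopen set of sequences agreeing with `x` up to `k`. -/
def cyl (x : ℕ → Bool) (k : ℕ) : Set (ℕ → Bool) := {y | ∀ i < k, y i = x i}

theorem isClopen_cyl (x : ℕ → Bool) (k : ℕ) : IsClopen (cyl x k) := by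
  have : cyl x k = ⋂ i ∈ Set.Iio k, (fun y : ℕ → Bool => y i) ⁻¹' {x i} := by
    ext y
    simp [cyl]
  rw [this]
  exact (Set.finite_Iio k).isClopen_biInter fun i _ =>
    (isClopen_discrete _).preimage (continuous_apply i)

theorem mem_cyl_self (x : ℕ → Bool) (k : ℕ) : x ∈ cyl x k := fun _ _ => rfl

theorem exists_cyl_subset {x : ℕ → Bool} {V : Set (ℕ → Bool)} (hV : IsOpen V) (hx : x ∈ V) :
    ∃ k, cyl x k ⊆ V := by
  obtain ⟨I, u, hu, hs⟩ := isOpen_pi_iff.1 hV x hx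
  refine ⟨I.sup id + 1, fun y hy => hs fun i hi => ?_⟩
  rw [hy i (Nat.lt_succ_of_le (Finset.le_sup (f := id) hi))]
  exact (hu i hi).2

theorem perfect_inter_clopen {M V : Set (ℕ → Bool)} (hM : Perfect M) (hV : IsClopen V) :
    Perfect (M ∩ V) := by
  refine ⟨hM.closed.inter hV.1, ?_⟩
  rw [Set.inter_comm]
  exact hM.acc.open_inter hV.2

theorem exists_perfect_subset_inter {M V : Set (ℕ → Bool)} (hM : Perfect M) (hV : IsOpen V)
    (h : (M ∩ V).Nonempty) : ∃ P ∈ PerfectSets, P ⊆ M ∩ V := by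
  obtain ⟨x, hxM, hxV⟩ := h
  obtain ⟨k, hk⟩ := exists_cyl_subset hV hxV
  exact ⟨M ∩ cyl x k, ⟨perfect_inter_clopen hM (isClopen_cyl x k), x, hxM, mem_cyl_self x k⟩,
    Set.inter_subset_inter_right _ hk⟩

theorem exists_disjoint_perfect {M : Set (ℕ → Bool)} (hM : M ∈ PerfectSets) (k : ℕ) :
    ∃ P : Bool → Set (ℕ → Bool), (∀ b, P b ∈ PerfectSets ∧ P b ⊆ M) ∧
      Disjoint (P true) (P false) ∧ ∀ b, ∀ x ∈ P b, ∀ y ∈ P b, ∀ i < k, x i = y i := by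
  obtain ⟨x, hx⟩ := hM.2
  obtain ⟨P, Q, ⟨hP, hPn, hPM⟩, ⟨hQ, hQn, hQM⟩, hd⟩ :=
    (perfect_inter_clopen hM.1 (isClopen_cyl x k)).splitting ⟨x, hx, mem_cyl_self x k⟩
  refine ⟨fun b => bif b then P else Q, fun b => ?_, hd, fun b y hy z hz i hi => ?_⟩
  · cases b
    · exact ⟨⟨hQ, hQn⟩, hQM.trans Set.inter_subset_left⟩
    · exact ⟨⟨hP, hPn⟩, hPM.trans Set.inter_subset_left⟩
  · cases b
    · rw [(hQM hy).2 i hi, (hQM hz).2 i hi]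
    · rw [(hPM hy).2 i hi, (hPM hz).2 i hi]

/-- The set is the intersection over the levels of the unions of the pieces, with lists growing at
the head. Each level has finitely many disjoint closed pieces, so each piece is relatively open in
the union; this gives the last clause. -/
theorem exists_perfect_of_scheme (A : List Bool → Set (ℕ → Bool))
    (hc : ∀ σ, IsClosed (A σ)) (hne : ∀ σ, (A σ).Nonempty) (hsub : ∀ b σ, A (b :: σ) ⊆ A σ)
    (hdisj : ∀ σ, Disjoint (A (true :: σ)) (A (false :: σ)))
    (hdiam : ∀ b σ, ∀ x ∈ A (b :: σ), ∀ y ∈ A (b :: σ), ∀ i < σ.length, x i = y i) :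
    ∃ M ∈ PerfectSets, M ⊆ A [] ∧
      ∀ k, ∀ x ∈ M, ∃ σ : List Bool, σ.length = k ∧ ∃ V, IsOpen V ∧ x ∈ V ∧ M ∩ V ⊆ A σ := by
  have hfin : ∀ k, {σ : List Bool | σ.length = k}.Finite := fun k => List.finite_length_eq Bool k
  let P : ℕ → Set (ℕ → Bool) := fun k => ⋃ σ ∈ {σ : List Bool | σ.length = k}, A σ
  have hPc : ∀ k, IsClosed (P k) := fun k => (hfin k).isClosed_biUnion fun σ _ => hc σ
  have hmemP : ∀ k x, x ∈ P k ↔ ∃ σ : List Bool, σ.length = k ∧ x ∈ A σ := by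
    intro k x
    simp [P]
  have hPsub : ∀ k, P (k + 1) ⊆ P k := by
    intro k x hx
    obtain ⟨σ, hσ, hx⟩ := (hmemP _ _).1 hx
    cases σ with
    | nil => simp at hσ
    | cons b σ => exact (hmemP _ _).2 ⟨σ, by simpa using hσ, hsub b σ hx⟩
  have hPanti : Antitone P := antitone_nat_of_succ_le hPsub
  have hbranch : ∀ σ, ∃ x ∈ A σ, ∀ k, x ∈ P k := by
    intro σ
    let B : ℕ → Set (ℕ → Bool) := fun n => A (List.replicate n true ++ σ)
    have hB : (⋂ n, B n).Nonempty :=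
      IsCompact.nonempty_iInter_of_sequence_nonempty_isCompact_isClosed B
        (fun n => by
          simp only [B, List.replicate_succ, List.cons_append]
          exact hsub _ _)
        (fun n => hne _) (hc _).isCompact (fun n => hc _)
    obtain ⟨x, hx⟩ := hB
    rw [Set.mem_iInter] at hx
    refine ⟨x, by simpa [B] using hx 0, fun k => ?_⟩
    exact hPanti (Nat.le_add_right k σ.length) ((hmemP _ _).2 ⟨_, by simp, hx k⟩)
  have hdis : ∀ k, ∀ σ τ : List Bool, σ.length = k → τ.length = k → σ ≠ τ →
      Disjoint (A σ) (A τ) := by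
    intro k
    induction k with
    | zero =>
      intro σ τ hσ hτ h
      exact absurd ((List.eq_nil_of_length_eq_zero hσ).trans
        (List.eq_nil_of_length_eq_zero hτ).symm) h
    | succ k ih =>
      intro σ τ hσ hτ h
      cases σ with
      | nil => simp at hσ
      | cons b σ =>
        cases τ with
        | nil => simp at hτ
        | cons c τ =>
          by_cases hst : σ = τ
          · subst hst
            cases b <;> cases c
            · exact absurd rfl h
            · exact (hdisj σ).symm
            · exact hdisj σ
            · exact absurd rfl h
          · exact (ih σ τ (by simpa using hσ) (by simpa using hτ) hst).mono (hsub _ _) (hsub _ _)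
  refine ⟨⋂ k, P k, ⟨⟨isClosed_iInter hPc, ?_⟩, ?_⟩, ?_, ?_⟩
  · rw [preperfect_iff_nhds]
    intro x hx U hU
    rw [Set.mem_iInter] at hx
    obtain ⟨V, hVU, hV, hxV⟩ := mem_nhds_iff.1 hU
    obtain ⟨k, hk⟩ := exists_cyl_subset hV hxV
    -- Two extra levels: the newest letter is flipped to produce another point, while the common
    -- parent piece forces agreement on the first `k` coordinates.
    obtain ⟨σ, hσ, hxσ⟩ := (hmemP _ _).1 (hx (k + 2))
    match σ, hσ with
    | b :: c :: σ, hσ =>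
      obtain ⟨y, hy, hyP⟩ := hbranch ((!b) :: c :: σ)
      refine ⟨y, ⟨hVU (hk fun i hi => ?_), Set.mem_iInter.2 hyP⟩, ?_⟩
      · exact hdiam c σ _ (hsub _ _ hy) _ (hsub _ _ hxσ) i (by simp at hσ; omega)
      · rintro rfl
        exact Set.disjoint_left.1 (hdis (k + 2) (b :: c :: σ) ((!b) :: c :: σ) hσ hσ (by simp))
          hxσ hy
  · obtain ⟨x, -, hx⟩ := hbranch []
    exact ⟨x, Set.mem_iInter.2 hx⟩
  · intro x hx
    obtain ⟨σ, hσ, hxσ⟩ := (hmemP _ _).1 (Set.mem_iInter.1 hx 0)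
    rwa [List.eq_nil_of_length_eq_zero hσ] at hxσ
  · intro k x hx
    obtain ⟨σ, hσ, hxσ⟩ := (hmemP _ _).1 (Set.mem_iInter.1 hx k)
    refine ⟨σ, hσ, (⋃ τ ∈ {τ : List Bool | τ.length = k} \ {σ}, A τ)ᶜ, ?_, ?_, ?_⟩
    · exact (((hfin k).subset Set.sdiff_subset).isClosed_biUnion fun τ _ => hc τ).isOpen_compl
    · simp only [Set.mem_compl_iff, Set.mem_iUnion, not_exists]
      rintro τ ⟨hτ, hne⟩ hxτ
      exact Set.disjoint_left.1 (hdis k σ τ hσ hτ fun h => hne h.symm) hxσ hxτ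
    · rintro y ⟨hy, hyV⟩
      obtain ⟨τ, hτ, hyτ⟩ := (hmemP _ _).1 (Set.mem_iInter.1 hy k)
      by_cases h : τ = σ
      · rwa [← h]
      · exact absurd (Set.mem_biUnion (show τ ∈ {τ : List Bool | τ.length = k} \ {σ} from
          ⟨hτ, h⟩) hyτ) hyV

/-- An uncountable set contains, for every map to a second countable space, an uncountable subset
all of whose points are limits, in the sense of the map, of other points of the subset. -/
theorem exists_denseInItself {α Z : Type*} [TopologicalSpace Z] [SecondCountableTopology Z]
    (Θ : α → Z) {I : Set α} (hI : ¬ I.Countable) :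
    ∃ D ⊆ I, ¬ D.Countable ∧ ∀ x ∈ D, ∀ O, IsOpen O → Θ x ∈ O → ∃ y ∈ D, y ≠ x ∧ Θ y ∈ O := by
  let E : Set α := ⋃ B ∈ {B ∈ TopologicalSpace.countableBasis Z | (I ∩ Θ ⁻¹' B).Countable},
    I ∩ Θ ⁻¹' B
  have hE : E.Countable :=
    ((TopologicalSpace.countable_countableBasis Z).mono (Set.sep_subset _ _)).biUnion
      fun B hB => hB.2
  refine ⟨I \ E, Set.sdiff_subset, fun h => hI ?_, fun x hx O hO hxO => ?_⟩
  · exact (h.union hE).mono fun x hx => by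
      by_cases hxE : x ∈ E
      · exact Or.inr hxE
      · exact Or.inl ⟨hx, hxE⟩
  · obtain ⟨B, hB, hxB, hBO⟩ :=
      (TopologicalSpace.isBasis_countableBasis Z).exists_subset_of_mem_open hxO hO
    have hnc : ¬ (I ∩ Θ ⁻¹' B).Countable := fun h =>
      hx.2 (Set.mem_biUnion (show B ∈ {B ∈ TopologicalSpace.countableBasis Z |
        (I ∩ Θ ⁻¹' B).Countable} from ⟨hB, h⟩) ⟨hx.1, hxB⟩)
    by_contra hcon
    push Not at hcon
    refine hnc ((hE.union (Set.countable_singleton x)).mono fun y hy => ?_)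
    by_cases hyE : y ∈ E
    · exact Or.inl hyE
    · by_contra hyx
      simp only [Set.mem_union, not_or, Set.mem_singleton_iff] at hyx
      exact hcon y ⟨hy.1, hyE⟩ hyx.2 (hBO hy.2)

theorem not_countable_of_perfect {M : Set (ℕ → Bool)} (hM : M ∈ PerfectSets) :
    ¬ M.Countable := by
  intro h
  let := TopologicalSpace.upgradeIsCompletelyMetrizable (ℕ → Bool)
  obtain ⟨f, hf, -, hinj⟩ := hM.1.exists_nat_bool_injection hM.2
  have h2 : (Set.univ : Set (ℕ → Bool)).Countable :=
    Set.MapsTo.countable_of_injOn (fun x _ => hf ⟨x, rfl⟩) hinj.injOn h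
  have h3 := Cardinal.mk_le_aleph0_iff.2 (Set.countable_univ_iff.1 h2)
  exact absurd h3 (by simp [Cardinal.aleph0_lt_continuum])

/-! ### Idempotent ultrafilters on located words -/

/-- In a compact right topological semigroup, a closed subsemigroup `C` contains an idempotent
that is minimal among the idempotents of `C`, and a closed subsemigroup `D` for which `C` acts on
both sides contains an idempotent below it. -/
theorem exists_minimal_idempotent {M : Type*} [Semigroup M] [TopologicalSpace M] [CompactSpace M]
    [T2Space M] (hcont : ∀ r : M, Continuous (· * r)) {C D : Set M} (hC : IsClosed C)
    (hCne : C.Nonempty) (hCC : ∀ x ∈ C, ∀ y ∈ C, x * y ∈ C) (hD : IsClosed D)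
    (hDne : D.Nonempty) (hDD : ∀ x ∈ D, ∀ y ∈ D, x * y ∈ D) (hCD : ∀ x ∈ C, ∀ y ∈ D, x * y ∈ D)
    (hDC : ∀ x ∈ D, ∀ y ∈ C, x * y ∈ D) :
    ∃ p ∈ C, ∃ q ∈ D, p * p = p ∧ q * q = q ∧ q * p = q ∧ p * q = q ∧
      ∀ e ∈ C, e * e = e → e * p = e → p * e = e → e = p := by
  let S : Set (Set M) := {I | I ⊆ C ∧ IsClosed I ∧ I.Nonempty ∧ ∀ x ∈ C, ∀ y ∈ I, x * y ∈ I}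
  obtain ⟨I, -, hI⟩ : ∃ I ⊆ C, Minimal (· ∈ S) I := by
    refine zorn_superset_nonempty S (fun c hcS hc hcne => ?_) C ⟨subset_rfl, hC, hCne, hCC⟩
    refine ⟨⋂₀ c, ⟨?_, isClosed_sInter fun t ht => (hcS ht).2.1, ?_, ?_⟩,
      fun s hs => Set.sInter_subset_of_mem hs⟩
    · obtain ⟨t, ht⟩ := hcne
      exact (Set.sInter_subset_of_mem ht).trans (hcS ht).1
    · rw [Set.sInter_eq_iInter]
      have := hcne.coe_sort
      exact IsCompact.nonempty_iInter_of_directed_nonempty_isCompact_isClosed _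
        (DirectedOn.directed_val (IsChain.directedOn hc.symm))
        (fun i => (hcS i.2).2.2.1) (fun i => (hcS i.2).2.1.isCompact) fun i => (hcS i.2).2.1
    · exact fun x hx y hy t ht => (hcS ht).2.2.2 x hx y (hy t ht)
  obtain ⟨hIC, hIcl, hIne, hImul⟩ := hI.prop
  obtain ⟨p, hpI, hpp⟩ := exists_idempotent_in_compact_subsemigroup hcont I hIne hIcl.isCompact
    fun x hx y hy => hImul x (hIC hx) y hy
  have hpC := hIC hpI
  -- `D * p` is a compact subsemigroup. An idempotent `x * p` in it absorbs `p` on the right, and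
  -- multiplying by `p` on the left yields an idempotent below `p`.
  obtain ⟨q, ⟨x, hx, rfl⟩, hqq⟩ := exists_idempotent_in_compact_subsemigroup hcont ((· * p) '' D)
    (hDne.image _) (hD.isCompact.image (hcont p)) (by
      rintro _ ⟨x, hx, rfl⟩ _ ⟨y, hy, rfl⟩
      exact ⟨x * p * y, hDD _ (hDC x hx p hpC) y hy, by simp only [mul_assoc]⟩)
  dsimp only at hqq
  have hqp : x * p * p = x * p := by rw [mul_assoc, hpp]
  refine ⟨p, hpC, p * (x * p), hCD p hpC _ (hDC x hx p hpC), hpp, ?_, ?_, ?_, ?_⟩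
  · calc p * (x * p) * (p * (x * p)) = p * ((x * p * p) * (x * p)) := by simp only [mul_assoc]
      _ = p * (x * p) := by rw [hqp, hqq]
  · rw [mul_assoc, hqp]
  · rw [← mul_assoc, hpp]
  · intro e he hee hep hpe
    -- `C * e` is a closed left ideal of `C` inside the minimal one, hence contains `p`. So `p = t *
    -- e`, which gives `p * e = p`, while `p * e = e`.
    have hsub : (· * e) '' C ⊆ I := by
      rintro _ ⟨y, hy, rfl⟩
      have : y * e = (y * e) * p := by rw [mul_assoc, hep]
      dsimp only
      rw [this]
      exact hImul _ (hCC y hy e he) p hpI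
    have hmem : (· * e) '' C ∈ S := by
      refine ⟨hsub.trans hIC, (hC.isCompact.image (hcont e)).isClosed, hCne.image _, ?_⟩
      rintro y hy _ ⟨z, hz, rfl⟩
      exact ⟨y * z, hCC y hy z hz, by simp only [mul_assoc]⟩
    obtain ⟨t, -, ht⟩ : p ∈ (· * e) '' C := hI.eq_of_subset hmem hsub ▸ hpI
    dsimp only at ht
    calc e = p * e := hpe.symm
      _ = p := by rw [← ht, mul_assoc, hee]

theorem Loc.append {Ls : ℕ → Finset L} {m n : ℕ} {t u : List (ℕ × Option L)}
    (ht : Loc Ls m t) (htn : ∀ p ∈ t, p.1 < n) (hu : Loc Ls (max m n) u) :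
    Loc Ls m (t ++ u) := by
  refine ⟨by simp [ht.1], List.pairwise_append.2 ⟨ht.2.1, hu.2.1, fun p hp q hq => ?_⟩,
    fun p hp => ?_⟩
  · exact (htn p hp).trans_le ((le_max_right _ _).trans (hu.2.2 q hq).1)
  · rcases List.mem_append.1 hp with hp | hp
    · exact ht.2.2 p hp
    · exact ⟨(le_max_left _ _).trans (hu.2.2 p hp).1, (hu.2.2 p hp).2⟩

theorem Loc.substitute {Ls : ℕ → Finset L} (hmono : Monotone Ls) {m n : ℕ}
    {t : List (ℕ × Option L)} {c : Option L} (hc : ∀ l, c = some l → l ∈ Ls n)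
    (ht : Loc Ls (max m n) t) : Loc Ls m (t.map fun p => (p.1, p.2.or c)) := by
  refine ⟨by simpa using ht.1, ?_, fun p hp => ?_⟩
  · rw [List.pairwise_map]
    exact ht.2.1
  · obtain ⟨q, hq, rfl⟩ := List.mem_map.1 hp
    obtain ⟨h1, h2⟩ := ht.2.2 q hq
    refine ⟨(le_max_left _ _).trans h1, fun l hl => ?_⟩
    rcases Option.or_eq_some_iff.1 hl with h | h
    · exact h2 l h
    · exact hmono ((le_max_right _ _).trans h1) (hc l h.2)

open Filter in
/-- The ultrafilters behind the infinite Hales-Jewett theorem. -/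
theorem exists_ultrafilters {Ls : ℕ → Finset L} (hmono : Monotone Ls)
    (hunion : ∀ l : L, ∃ n, l ∈ Ls n) [Nonempty L] :
    ∃ p q : Ultrafilter (List (ℕ × Option L)),
      (∀ k, ∀ᶠ t in (q : Filter _), Loc Ls k t ∧ ∃ x ∈ t, x.2 = none) ∧
      (∀ P : List (ℕ × Option L) → Prop, (∀ᶠ t in (p : Filter _), P t) →
        ∀ᶠ t in (p : Filter _), ∀ᶠ u in (p : Filter _), P (t ++ u)) ∧
      ∀ l : L, q.map (fun t => t.map fun x => (x.1, x.2.or (some l))) = p := by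
  let W := List (ℕ × Option L)
  -- Concatenation of arbitrary lists is total. Locatedness is recovered for ultrafilters in `B`,
  -- since the second factor can be taken to the right of the first.
  let _ : Semigroup W := { mul := List.append, mul_assoc := List.append_assoc }
  let _ : Semigroup (Ultrafilter W) := Ultrafilter.semigroup
  have hmul : ∀ U V : Ultrafilter W, ∀ P : W → Prop,
      (∀ᶠ t in ((U * V : Ultrafilter W) : Filter W), P t) ↔
        ∀ᶠ t in (U : Filter W), ∀ᶠ u in (V : Filter W), P (List.append t u) := fun U V P => Iff.rfl
  let B : Set (Ultrafilter W) := {U | ∀ k, ∀ᶠ t in (U : Filter W), Loc Ls k t}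
  let CL : Set (Ultrafilter W) := B ∩ {U | ∀ᶠ t : W in (U : Filter W), ∀ x ∈ t, x.2 ≠ none}
  let CV : Set (Ultrafilter W) := B ∩ {U | ∀ᶠ t : W in (U : Filter W), ∃ x ∈ t, x.2 = none}
  have hBcl : IsClosed B := by
    have : B = ⋂ k, {U : Ultrafilter W | {t | Loc Ls k t} ∈ U} := by
      ext U
      simp only [Set.mem_iInter]
      rfl
    rw [this]
    exact isClosed_iInter fun k => ultrafilter_isClosed_basic _
  have hCLcl : IsClosed CL := hBcl.inter (ultrafilter_isClosed_basic _)
  have hCVcl : IsClosed CV := hBcl.inter (ultrafilter_isClosed_basic _)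
  have hBmul : ∀ U ∈ B, ∀ V ∈ B, U * V ∈ B := by
    intro U hU V hV k
    rw [hmul]
    filter_upwards [hU k] with t ht
    obtain ⟨n, -, hn⟩ := exists_lt_of_list t 0
    filter_upwards [hV (max k n)] with u hu
    exact ht.append hn hu
  have hφ : ∀ l : L, ∀ U ∈ B,
      U.map (fun t : W => (t.map fun x => (x.1, x.2.or (some l)) : W)) ∈ CL := by
    intro l U hU
    obtain ⟨n, hn⟩ := hunion l
    refine ⟨fun k => ?_, ?_⟩
    · change ∀ᶠ t : W in (U : Filter W), _
      filter_upwards [hU (max k n)] with t ht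
      exact ht.substitute hmono (by rintro _ ⟨⟩; exact hn)
    · change ∀ᶠ t : W in (U : Filter W), _
      refine Eventually.of_forall fun t x hx => ?_
      obtain ⟨y, -, rfl⟩ := List.mem_map.1 hx
      cases y.2 <;> simp
  have hCVne : CV.Nonempty := by
    let F : Filter W := ⨅ k : ℕ, 𝓟 {t : W | Loc Ls k t ∧ ∃ x ∈ t, x.2 = none}
    have hF : F.NeBot := by
      refine iInf_neBot_of_directed' ?_ fun k => ?_
      · refine directed_of_isDirected_le fun i j hij => ?_
        exact principal_mono.2 fun t ht => ⟨ht.1.mono hij, ht.2⟩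
      · rw [principal_neBot_iff]
        exact ⟨[(k, none)], loc_singleton le_rfl, (k, none), List.mem_cons_self, rfl⟩
    have hmem : ∀ k, ∀ᶠ t : W in (Ultrafilter.of F : Filter W),
        Loc Ls k t ∧ ∃ x ∈ t, x.2 = none := fun k =>
      Ultrafilter.of_le F (mem_iInf_of_mem k (mem_principal_self _))
    exact ⟨Ultrafilter.of F, fun k => (hmem k).mono fun t ht => ht.1,
      (hmem 0).mono fun t ht => ht.2⟩
  have hCLne : CL.Nonempty :=
    ⟨_, hφ (Classical.arbitrary L) _ hCVne.some_mem.1⟩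
  obtain ⟨p, hp, q, hq, hpp, hqq, hqp, hpq, hmin⟩ :=
    exists_minimal_idempotent (fun r => Ultrafilter.continuous_mul_left r) hCLcl hCLne
      (fun U hU V hV => ⟨hBmul U hU.1 V hV.1, by
        change ∀ᶠ t in (U : Filter W), ∀ᶠ u in (V : Filter W), _
        filter_upwards [hU.2] with t ht
        filter_upwards [hV.2] with u hu
        intro x hx
        rcases List.mem_append.1 hx with hx | hx
        · exact ht x hx
        · exact hu x hx⟩)
      hCVcl hCVne
      (fun U hU V hV => ⟨hBmul U hU.1 V hV.1, by
        change ∀ᶠ t in (U : Filter W), ∀ᶠ u in (V : Filter W), _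
        filter_upwards [hU.2] with t ⟨x, hx, hxn⟩
        exact Eventually.of_forall fun u => ⟨x, List.mem_append_left _ hx, hxn⟩⟩)
      (fun U hU V hV => ⟨hBmul U hU.1 V hV.1, by
        change ∀ᶠ t in (U : Filter W), ∀ᶠ u in (V : Filter W), _
        refine Eventually.of_forall fun t => ?_
        filter_upwards [hV.2] with u ⟨x, hx, hxn⟩
        exact ⟨x, List.mem_append_right _ hx, hxn⟩⟩)
      (fun U hU V hV => ⟨hBmul U hU.1 V hV.1, by
        change ∀ᶠ t in (U : Filter W), ∀ᶠ u in (V : Filter W), _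
        filter_upwards [hU.2] with t ⟨x, hx, hxn⟩
        exact Eventually.of_forall fun u => ⟨x, List.mem_append_left _ hx, hxn⟩⟩)
  refine ⟨p, q, fun k => (hq.1 k).and hq.2, fun P hP => ?_, fun l => ?_⟩
  · rw [← hpp] at hP
    exact hP
  -- Substituting `l` is a homomorphism that fixes words without variable, so it fixes `p`. It sends
  -- `q` to an idempotent of `CL` below `p`, which is `p` by minimality.
  · let φ : W → W := fun t => (t.map fun x => (x.1, x.2.or (some l)))
    have hφmul : ∀ U V : Ultrafilter W, (U * V).map φ = U.map φ * V.map φ := by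
      intro U V
      refine Ultrafilter.coe_inj.mp (Filter.ext' fun P => ?_)
      change (∀ᶠ t in (U : Filter W), ∀ᶠ u in (V : Filter W), P (φ (List.append t u))) ↔
        (∀ᶠ t in (U : Filter W), ∀ᶠ u in (V : Filter W), P (List.append (φ t) (φ u)))
      have : ∀ t u, φ (List.append t u) = List.append (φ t) (φ u) := fun t u =>
        List.map_append
      simp only [this]
      exact Iff.rfl
    have hφp : p.map φ = p := by
      refine Ultrafilter.coe_inj.mp ?_
      rw [Ultrafilter.coe_map]
      refine (Filter.map_congr (m₂ := id) ?_).trans Filter.map_id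
      filter_upwards [hp.2] with t ht
      change t.map _ = t
      refine (List.map_congr_left fun x hx => ?_).trans (List.map_id t)
      obtain ⟨c, hc⟩ := Option.ne_none_iff_exists'.1 (ht x hx)
      rw [hc, Option.some_or, ← hc]
      rfl
    refine hmin _ (hφ l q hq.1) ?_ ?_ ?_
    · exact (hφmul q q).symm.trans (congrArg _ hqq)
    · calc q.map φ * p = q.map φ * p.map φ := by rw [hφp]
        _ = q.map φ := (hφmul q p).symm.trans (congrArg _ hqp)
    · calc p * q.map φ = p.map φ * q.map φ := by rw [hφp]
        _ = q.map φ := (hφmul p q).symm.trans (congrArg _ hpq)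

/-! ### The parametrized pigeonhole principle -/

open Filter in
open Classical in
-- A Galvin–Glazer construction for infinitely many points at once. Each stage handles finitely many
-- points and words; every point present receives a nearby twin that behaves the same on the
-- finitely many words in play, so the points collected at the end form a dense-in-itself set.
theorem exists_homogeneous_of_uncountable [Countable L] {Ls : ℕ → Finset L}
    {p q : Ultrafilter (List (ℕ × Option L))}
    (hq : ∀ k, ∀ᶠ t in (q : Filter _), Loc Ls k t ∧ ∃ x ∈ t, x.2 = none)
    (hp : ∀ P : List (ℕ × Option L) → Prop, (∀ᶠ t in (p : Filter _), P t) →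
      ∀ᶠ t in (p : Filter _), ∀ᶠ u in (p : Filter _), P (t ++ u))
    (hqp : ∀ l : L, q.map (fun t => t.map fun x => (x.1, x.2.or (some l))) = p)
    (κ : (ℕ → Bool) → List (ℕ × Option L) → Prop) {I : Set (ℕ → Bool)} (hI : ¬ I.Countable)
    (hκ : ∀ x ∈ I, ∀ᶠ u in (p : Filter _), κ x u) (j : ℕ) :
    ∃ D ⊆ I, D.Nonempty ∧ (∀ x ∈ D, ∀ k, ∃ y ∈ D, y ≠ x ∧ y ∈ cyl x k) ∧
      ∃ z : ℕ → List (ℕ × Option L),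
        (∀ n, j ≤ n → Loc Ls n (z n) ∧ ∃ x ∈ z n, x.2 = none) ∧
        (∀ n k, j ≤ n → n < k → ∀ p ∈ z n, ∀ q ∈ z k, p.1 < q.1) ∧
        ∀ t, Loc Ls j t → (∀ x ∈ t, x.2 ≠ none) → ∀ x ∈ D, κ x (bind z t) := by
  -- A point is sent to itself, its set of good words and its set of words with `p`-almost all
  -- continuations good. The target is second countable because `L` is countable.
  obtain ⟨D, hDI, hDunc, hD⟩ := exists_denseInItself
    (fun x : ℕ → Bool => (x, (fun t => decide (κ x t) : List (ℕ × Option L) → Bool),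
      (fun t => decide (∀ᶠ u in (p : Filter _), κ x (t ++ u)) : List (ℕ × Option L) → Bool))) hI
  have hc1 : ∀ t, Continuous fun z : (ℕ → Bool) × (List (ℕ × Option L) → Bool) ×
      (List (ℕ × Option L) → Bool) => z.2.1 t := fun t => by fun_prop
  have hc2 : ∀ t, Continuous fun z : (ℕ → Bool) × (List (ℕ × Option L) → Bool) ×
      (List (ℕ × Option L) → Bool) => z.2.2 t := fun t => by fun_prop
  have hD' : ∀ x ∈ D, ∀ k, ∀ P : Finset (List (ℕ × Option L)), ∃ y ∈ D, y ≠ x ∧ y ∈ cyl x k ∧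
      ∀ t ∈ P, (κ y t ↔ κ x t) ∧ ((∀ᶠ u in (p : Filter _), κ y (t ++ u)) ↔
        ∀ᶠ u in (p : Filter _), κ x (t ++ u)) := by
    intro x hx k P
    obtain ⟨y, hy, hyx, hyO⟩ := hD x hx
      ({z | z.1 ∈ cyl x k} ∩ ⋂ t ∈ (P : Set (List (ℕ × Option L))),
        ({z | z.2.1 t = decide (κ x t)} ∩
          {z | z.2.2 t = decide (∀ᶠ u in (p : Filter _), κ x (t ++ u))})) (by
        refine ((isClopen_cyl x k).2.preimage continuous_fst).inter
          (P.finite_toSet.isOpen_biInter fun t _ => IsOpen.inter ?_ ?_)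
        · exact (isOpen_discrete ({decide (κ x t)} : Set Bool)).preimage (hc1 t)
        · exact (isOpen_discrete
            ({decide (∀ᶠ u in (p : Filter _), κ x (t ++ u))} : Set Bool)).preimage (hc2 t))
      ⟨mem_cyl_self x k, by simp⟩
    refine ⟨y, hy, hyx, hyO.1, fun t ht => ?_⟩
    have h := Set.mem_iInter₂.1 hyO.2 t ht
    exact ⟨decide_eq_decide.1 h.1, decide_eq_decide.1 h.2⟩
  obtain ⟨x₀, hx₀⟩ : D.Nonempty := by
    by_contra h
    rw [Set.not_nonempty_iff_eq_empty] at h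
    exact hDunc (h ▸ Set.countable_empty)
  -- A state holds the points, the evaluated words built so far, a strict bound for the indices in
  -- use and the latest variable word.
  let St := Finset (ℕ → Bool) × Finset (List (ℕ × Option L)) × ℕ × List (ℕ × Option L)
  let Inv : ℕ → St → Prop := fun _ s => (∀ x ∈ s.1, x ∈ D ∧ ∀ t ∈ s.2.1,
    (t ≠ [] → κ x t) ∧ ∀ᶠ u in (p : Filter _), κ x (t ++ u))
  let Rel : ℕ → St → St → Prop := fun k s s' => s.1 ⊆ s'.1 ∧ s.2.1 ⊆ s'.2.1 ∧
    (∀ x ∈ s.1, ∃ y ∈ s'.1, y ≠ x ∧ y ∈ cyl x k) ∧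
    (Loc Ls (max (j + k) s.2.2.1) s'.2.2.2 ∧ ∃ x ∈ s'.2.2.2, x.2 = none) ∧
    s.2.2.1 ≤ s'.2.2.1 ∧ (∀ x ∈ s'.2.2.2, x.1 < s'.2.2.1) ∧
    ∀ t ∈ s.2.1, ∀ l ∈ Ls (j + k), t ++ s'.2.2.2.map (fun x => (x.1, x.2.or (some l))) ∈ s'.2.1
  -- The start is the empty word, which has good continuations but need not be good itself; hence
  -- the proviso `t ≠ []` in `Inv`.
  obtain ⟨S, hS0, hS⟩ := exists_seq_of_step Inv Rel ({x₀}, {[]}, 0, []) (by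
      intro x hx
      obtain rfl := Finset.mem_singleton.1 hx
      refine ⟨hx₀, fun t ht => ?_⟩
      obtain rfl := Finset.mem_singleton.1 ht
      exact ⟨fun h => absurd rfl h, hκ x (hDI hx₀)⟩) (by
    rintro k ⟨E, P, bd, f₀⟩ hs
    choose! g hgD hgne hgcyl hgP using fun x (hx : x ∈ E) => hD' x (hs x hx).1 k P
    let E' := E ∪ E.image g
    have hE' : ∀ x ∈ E', x ∈ D ∧ ∀ t ∈ P,
        (t ≠ [] → κ x t) ∧ ∀ᶠ u in (p : Filter _), κ x (t ++ u) := by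
      intro x hx
      rcases Finset.mem_union.1 hx with hx | hx
      · exact hs x hx
      · obtain ⟨y, hy, rfl⟩ := Finset.mem_image.1 hx
        refine ⟨hgD y hy, fun t ht => ?_⟩
        rw [(hgP y hy t ht).1, (hgP y hy t ht).2]
        exact (hs y hy).2 t ht
    have hev : ∀ᶠ v in (p : Filter _), ∀ x ∈ E', ∀ t ∈ P,
        κ x (t ++ v) ∧ ∀ᶠ u in (p : Filter _), κ x (t ++ v ++ u) := by
      rw [eventually_all_finset]
      intro x hx
      rw [eventually_all_finset]
      intro t ht
      have h1 := ((hE' x hx).2 t ht).2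
      filter_upwards [h1, hp _ h1] with v hv hv'
      exact ⟨hv, by simpa only [List.append_assoc] using hv'⟩
    -- Every substitution carries `q` to `p`, so a single variable word works for all the finitely
    -- many letters of the stage.
    have hpull : ∀ l : L, ∀ R : List (ℕ × Option L) → Prop, (∀ᶠ v in (p : Filter _), R v) →
        ∀ᶠ f in (q : Filter (List (ℕ × Option L))),
          R (f.map fun x => (x.1, x.2.or (some l))) := by
      intro l R h
      rw [← hqp l] at h
      exact h
    have hev' : ∀ᶠ f in (q : Filter (List (ℕ × Option L))), ∀ l ∈ Ls (j + k), ∀ x ∈ E', ∀ t ∈ P,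
        κ x (t ++ f.map (fun x => (x.1, x.2.or (some l)))) ∧ ∀ᶠ u in (p : Filter _),
          κ x (t ++ f.map (fun x => (x.1, x.2.or (some l))) ++ u) := by
      rw [eventually_all_finset]
      intro l _
      exact hpull l _ hev
    obtain ⟨f, hf, hfL⟩ := (hev'.and (hq (max (j + k) bd))).exists
    obtain ⟨bd', hbd, hbd'⟩ := exists_lt_of_list f bd
    refine ⟨(E', P ∪ (P ×ˢ Ls (j + k)).image
      (fun y => y.1 ++ f.map (fun x => (x.1, x.2.or (some y.2)))), bd', f), ?_, ?_⟩
    · intro x hx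
      refine ⟨(hE' x hx).1, fun t ht => ?_⟩
      rcases Finset.mem_union.1 ht with ht | ht
      · exact (hE' x hx).2 t ht
      · obtain ⟨⟨t', l⟩, htl, rfl⟩ := Finset.mem_image.1 ht
        rw [Finset.mem_product] at htl
        exact ⟨fun _ => (hf l htl.2 x hx t' htl.1).1, (hf l htl.2 x hx t' htl.1).2⟩
    · refine ⟨Finset.subset_union_left, Finset.subset_union_left, fun x hx => ?_, hfL, hbd, hbd',
        fun t ht l hl => ?_⟩
      · exact ⟨g x, Finset.mem_union_right _ (Finset.mem_image_of_mem g hx), hgne x hx,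
          hgcyl x hx⟩
      · exact Finset.mem_union_right _ (Finset.mem_image.2
          ⟨(t, l), Finset.mem_product.2 ⟨ht, hl⟩, rfl⟩))
  have hEmono : Monotone fun k => (S k).1 := monotone_nat_of_le_succ fun k => (hS k).2.1
  have hPmono : Monotone fun k => (S k).2.1 := monotone_nat_of_le_succ fun k => (hS k).2.2.1
  have hbmono : Monotone fun k => (S k).2.2.1 :=
    monotone_nat_of_le_succ fun k => (hS k).2.2.2.2.2.1
  refine ⟨{x | ∃ k, x ∈ (S k).1}, ?_, ⟨x₀, 0, by simp [hS0]⟩, ?_,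
    fun n => (S (n - j + 1)).2.2.2, ?_, ?_, ?_⟩
  · rintro x ⟨k, hx⟩
    exact hDI ((hS k).1 x hx).1
  · rintro x ⟨k, hx⟩ i
    obtain ⟨y, hy, hyx, hyc⟩ := (hS (max k i)).2.2.2.1 x (hEmono (le_max_left k i) hx)
    exact ⟨y, ⟨_, hy⟩, hyx, fun i' hi' => hyc i' (hi'.trans_le (le_max_right _ _))⟩
  · intro n hn
    obtain ⟨h1, h2⟩ := (hS (n - j)).2.2.2.2.1
    exact ⟨h1.mono (le_max_of_le_left (by omega)), h2⟩
  · intro n k hn hnk x hx y hy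
    calc x.1 < (S (n - j + 1)).2.2.1 := (hS (n - j)).2.2.2.2.2.2.1 x hx
      _ ≤ (S (k - j)).2.2.1 := hbmono (by omega)
      _ ≤ y.1 := (le_max_right _ _).trans ((hS (k - j)).2.2.2.2.1.1.2.2 y hy).1
  -- `z n` is chosen at step `n - j`, with letters from `Ls n`, and appears in state `n - j + 1`.
  -- Words persist once recorded, so indices may be skipped.
  · have key : ∀ t : List (ℕ × Option L), t.Pairwise (fun p q => p.1 < q.1) →
        (∀ p ∈ t, j ≤ p.1 ∧ ∀ l, p.2 = some l → l ∈ Ls p.1) → (∀ x ∈ t, x.2 ≠ none) →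
        ∀ k, (∀ p ∈ t, p.1 < j + k) →
          bind (fun n => (S (n - j + 1)).2.2.2) t ∈ (S k).2.1 := by
      intro t
      induction t using List.reverseRecOn with
      | nil =>
        intro _ _ _ k _
        exact hPmono (Nat.zero_le k) (by simp [hS0, bind])
      | append_singleton t x ih =>
        intro ht htl hts k hk
        obtain ⟨ht1, -, ht2⟩ := List.pairwise_append.1 ht
        have hx := htl x (by simp)
        obtain ⟨l, hl⟩ := Option.ne_none_iff_exists'.1 (hts x (by simp))
        have h1 := ih ht1 (fun p hp => htl p (by simp [hp])) (fun p hp => hts p (by simp [hp]))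
          (x.1 - j) fun p hp => by
            have := ht2 p hp x (by simp)
            omega
        have h2 := (hS (x.1 - j)).2.2.2.2.2.2.2 _ h1 l (by
          rw [Nat.add_sub_cancel' hx.1]
          exact hx.2 l hl)
        have h3 := hk x (by simp)
        refine hPmono (show x.1 - j + 1 ≤ k by omega) ?_
        simpa [bind, hl] using h2
    rintro t ht hts x ⟨k, hx⟩
    obtain ⟨k', -, hk'⟩ := exists_lt_of_list t 0
    have h1 := key t ht.2.1 ht.2.2 hts (max k k') fun p hp => by
      have := hk' p hp
      omega
    refine (((hS (max k k')).1 x (hEmono (le_max_left k k') hx)).2 _ h1).1 ?_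
    obtain ⟨y, hy⟩ := List.exists_mem_of_ne_nil _ ht.1
    obtain ⟨y', hy'⟩ := List.exists_mem_of_ne_nil _ (hS (y.1 - j)).2.2.2.2.1.1.1
    exact List.ne_nil_of_mem (mem_bind.2 ⟨y, hy, y', hy', rfl⟩)

theorem ne_none_of_map_some_eq_ev {X : VarWordSeq L} {t : List (ℕ × Option L)} {w : List L}
    (hw : w.map some = ev X.1 t) : ∀ p ∈ t, p.2 ≠ none := by
  intro p hp hn
  have h : none ∈ ev X.1 t :=
    List.mem_flatMap.2 ⟨p, hp, by rw [hn, subst_none]; exact X.2.1 p.1⟩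
  rw [← hw] at h
  simp at h

theorem countable_of_union {Ls : ℕ → Finset L} (hunion : ∀ l : L, ∃ n, l ∈ Ls n) :
    Countable L := by
  rw [← Set.countable_univ_iff]
  refine (Set.countable_iUnion fun n => (Ls n).countable_toSet).mono fun l _ => ?_
  exact Set.mem_iUnion.2 (hunion l)

/-- The perfect set is the closure of the dense-in-itself set; local constancy of the colour on `M`
extends homogeneity to it. On values without variable, the only ones finally used,
`List.reduceOption` just removes the `some`. -/
theorem exists_homogeneous [Countable L] {Ls : ℕ → Finset L} (hmono : Monotone Ls)
    {p q : Ultrafilter (List (ℕ × Option L))}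
    (hq : ∀ k, ∀ᶠ t in (q : Filter _), Loc Ls k t ∧ ∃ x ∈ t, x.2 = none)
    (hp : ∀ P : List (ℕ × Option L) → Prop, (∀ᶠ t in (p : Filter _), P t) →
      ∀ᶠ t in (p : Filter _), ∀ᶠ u in (p : Filter _), P (t ++ u))
    (hqp : ∀ l : L, q.map (fun t => t.map fun x => (x.1, x.2.or (some l))) = p)
    {M : Set (ℕ → Bool)} (hM : IsClosed M) (X : VarWordSeq L) (j : ℕ)
    (c : (ℕ → Bool) → List L → Prop)
    (hc : ∀ w t, Loc Ls j t → w.map some = ev X.1 t → ∀ x ∈ M, ∃ V, IsOpen V ∧ x ∈ V ∧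
      ∀ x' ∈ M ∩ V, (c x' w ↔ c x w))
    {I : Set (ℕ → Bool)} (hIM : I ⊆ M) (hI : ¬ I.Countable)
    (hcI : ∀ x ∈ I, ∀ᶠ u in (p : Filter _), c x (ev X.1 u).reduceOption) :
    ∃ M' ∈ PerfectSets, M' ⊆ M ∧ ∃ X', Ext Ls j X' X ∧
      ∀ x ∈ M', ∀ t w, Loc Ls j t → w.map some = ev X'.1 t → c x w := by
  obtain ⟨D, hDI, hDne, hDacc, z, hz, hzb, hzc⟩ := exists_homogeneous_of_uncountable hq hp hqp
    (fun x u => c x (ev X.1 u).reduceOption) hI hcI j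
  have hXB : Blk Ls X.1 0 (fun n => if n < j then X.1 n else ev X.1 (z n)) := by
    refine ⟨fun n => if n < j then [(n, none)] else z n, fun n => ?_, fun n k hnk p hp q hq => ?_⟩
    · by_cases hn : n < j
      · simp only [hn, if_true]
        exact ⟨loc_singleton (Nat.zero_le _), by rw [ev_singleton, subst_none]⟩
      · simp only [hn, if_false, and_true]
        exact (hz n (not_lt.1 hn)).1.mono (Nat.zero_le _)
    · dsimp only at hp hq
      split_ifs at hp hq with h1 h2 h2
      · simp only [List.mem_singleton] at hp hq
        subst hp hq
        exact hnk
      · simp only [List.mem_singleton] at hp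
        subst hp
        exact hnk.trans_le ((hz k (not_lt.1 h2)).1.2.2 q hq).1
      · omega
      · exact hzb n k (not_lt.1 h1) hnk p hp q hq
  let X' : VarWordSeq L := ⟨fun n => if n < j then X.1 n else ev X.1 (z n), fun n => by
    dsimp only
    split_ifs with hn
    · exact X.2.1 n
    · obtain ⟨x, hx, hxn⟩ := (hz n (not_lt.1 hn)).2
      exact List.mem_flatMap.2 ⟨x, hx, by rw [hxn, subst_none]; exact X.2.1 x.1⟩,
    hXB.rapidlyIncreasing X.2.2⟩
  have hX' : Ext Ls j X' X := ⟨hXB, fun n hn => by simp [X', hn]⟩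
  have hclM : closure D ⊆ M := closure_minimal (hDI.trans hIM) hM
  refine ⟨closure D, ⟨Preperfect.perfect_closure ?_, hDne.closure⟩, hclM, X', hX',
    fun x hx t w ht hw => ?_⟩
  · rw [preperfect_iff_nhds]
    intro x hx U hU
    obtain ⟨V, hVU, hV, hxV⟩ := mem_nhds_iff.1 hU
    obtain ⟨k, hk⟩ := exists_cyl_subset hV hxV
    obtain ⟨y, hy, hyx, hyc⟩ := hDacc x hx k
    exact ⟨y, ⟨hVU (hk hyc), hy⟩, hyx⟩
  · obtain ⟨σ, hσ, hσb⟩ := hXB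
    obtain ⟨V, hV, hxV, hVc⟩ := hc w (bind σ t) (ht.bind hmono (fun n => (hσ n).1) hσb)
      (hw.trans (ev_bind (z := X'.1) fun p _ => (hσ p.1).2)) x (hclM hx)
    obtain ⟨y, hyV, hyD⟩ := mem_closure_iff.1 hx V hV hxV
    rw [← hVc y ⟨hIM (hDI hyD), hyV⟩]
    have h := hzc t ht (ne_none_of_map_some_eq_ev hw) y hyD
    rw [← ev_bind (z := X'.1), ← hw] at h
    · simpa [List.reduceOption] using h
    · intro p hp
      simp [X', not_lt.2 (ht.2.2 p hp).1]

/-- The parametrized pigeonhole principle. -/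
theorem pigeonhole {Ls : ℕ → Finset L} (hmono : Monotone Ls)
    (hunion : ∀ l : L, ∃ n, l ∈ Ls n) [Nonempty L]
    {M : Set (ℕ → Bool)} (hM : M ∈ PerfectSets) (X : VarWordSeq L) (j : ℕ)
    (c : (ℕ → Bool) → List L → Prop)
    (hc : ∀ w t, Loc Ls j t → w.map some = ev X.1 t → ∀ x ∈ M, ∃ V, IsOpen V ∧ x ∈ V ∧
      ∀ x' ∈ M ∩ V, (c x' w ↔ c x w)) :
    ∃ M' ∈ PerfectSets, M' ⊆ M ∧ ∃ X', Ext Ls j X' X ∧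
      ((∀ x ∈ M', ∀ t w, Loc Ls j t → w.map some = ev X'.1 t → c x w) ∨
        ∀ x ∈ M', ∀ t w, Loc Ls j t → w.map some = ev X'.1 t → ¬ c x w) := by
  have := countable_of_union hunion
  obtain ⟨p, q, hq, hp, hqp⟩ := exists_ultrafilters hmono hunion
  -- The set of points preferring a colour need not be definable, so only its uncountability is
  -- used: the two sets cover the uncountable `M`.
  by_cases h : {x ∈ M | ∀ᶠ u in (p : Filter _), c x (ev X.1 u).reduceOption}.Countable
  · have h' : ¬ {x ∈ M | ∀ᶠ u in (p : Filter _), ¬ c x (ev X.1 u).reduceOption}.Countable := by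
      intro h'
      refine not_countable_of_perfect hM ((h.union h').mono fun x hx => ?_)
      rcases Ultrafilter.em p fun u => c x (ev X.1 u).reduceOption with h | h
      · exact Or.inl ⟨hx, h⟩
      · exact Or.inr ⟨hx, h⟩
    obtain ⟨M', hM', hMM, X', hX', hc'⟩ := exists_homogeneous hmono hq hp hqp hM.1.closed X j
      (fun x w => ¬ c x w) (fun w t ht hw x hx => by
        obtain ⟨V, hV, hxV, h⟩ := hc w t ht hw x hx
        exact ⟨V, hV, hxV, fun x' hx' => not_congr (h x' hx')⟩)
      (Set.sep_subset _ _) h' fun x hx => hx.2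
    exact ⟨M', hM', hMM, X', hX', Or.inr hc'⟩
  · obtain ⟨M', hM', hMM, X', hX', hc'⟩ := exists_homogeneous hmono hq hp hqp hM.1.closed X j
      c hc (Set.sep_subset _ _) h fun x hx => hx.2
    exact ⟨M', hM', hMM, X', hX', Or.inl hc'⟩

/-! ### Fusion of perfect sets and sequences -/

theorem finite_lists {α : Type*} {S : Set α} (hS : S.Finite) (n : ℕ) :
    {l : List α | (∀ x ∈ l, x ∈ S) ∧ l.length ≤ n}.Finite := by
  have := hS.to_subtype
  refine ((List.finite_length_le S n).image (List.map Subtype.val)).subset ?_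
  rintro l ⟨hl, hn⟩
  lift l to List S using hl
  exact ⟨l, by simpa using hn, rfl⟩

/-- The number of words, their lengths and their letters are all bounded in terms of `m`; this lets
one fusion stage treat every approximation located before `m`. -/
theorem finite_setOf_fblk {Ls : ℕ → Finset L} (hmono : Monotone Ls) (y : ℕ → List (Option L))
    (m : ℕ) : {b | FBlk Ls y m b}.Finite := by
  have hS : ((⋃ i ∈ Set.Iio m, {l | some l ∈ y i}) ∪ (Ls m : Set L)).Finite := by
    refine Set.Finite.union ((Set.finite_Iio m).biUnion fun i _ => ?_) (Ls m).finite_toSet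
    exact (List.finite_toSet (y i)).preimage (Option.some_injective L).injOn
  refine (finite_lists (finite_lists hS (∑ i ∈ Finset.range m, (y i).length)) m).subset ?_
  rintro b ⟨τ, hτ, hb⟩
  refine ⟨fun w hw => ?_, ?_⟩
  · obtain ⟨i, hi, rfl⟩ := List.getElem_of_mem hw
    obtain ⟨hl, hm, he⟩ := hτ i hi
    refine ⟨fun l hlw => ?_, ?_⟩
    · have h : some l ∈ ev y (τ i) := he ▸ List.mem_map_of_mem hlw
      obtain ⟨p, hp, hlp⟩ := List.mem_flatMap.1 h
      obtain ⟨d, hd, hdl⟩ := List.mem_map.1 hlp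
      rcases Option.or_eq_some_iff.1 hdl with h | h
      · exact Or.inl (Set.mem_biUnion (hm p hp) (show some l ∈ y p.1 from h ▸ hd))
      · exact Or.inr (hmono (hm p hp).le ((hl.2.2 p hp).2 l h.2))
    · rw [← List.length_map (f := some), he]
      exact length_ev_le y hl.2.1 hm
  · have hle : ∀ i, i < b.length → ∀ p ∈ τ i, i ≤ p.1 := by
      intro i
      induction i with
      | zero => exact fun _ p _ => Nat.zero_le _
      | succ i ih =>
        intro hi p hp
        obtain ⟨q, hq⟩ := List.exists_mem_of_ne_nil _ (hτ i (by omega)).1.1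
        exact (ih (by omega) q hq).trans_lt (hb i (i + 1) (by omega) hi q hq p hp)
    by_contra hlt
    obtain ⟨p, hp⟩ := List.exists_mem_of_ne_nil _ (hτ m (by omega)).1.1
    have h1 := hle m (by omega) p hp
    have h2 := (hτ m (by omega)).2.1 p hp
    omega

/-- The requirements are met one at a time, each shrinking one piece of the scheme and the common
sequence. Fixing `j` terms keeps the remaining `b` admissible, and heredity keeps what was achieved.
-/
theorem exists_decide_finset {Ls : ℕ → Finset L} (hmono : Monotone Ls)
    {D : ℕ → List (List L) → ℕ → Set (ℕ → Bool) → VarWordSeq L → Prop}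
    {Q : Set (ℕ → Bool)} {Y : VarWordSeq L} {j : ℕ}
    (hered : ∀ i b j M M' X X', M' ⊆ M → Blk Ls X.1 0 X'.1 → D i b j M X → D i b j M' X')
    (hdense : ∀ i b M X, M ∈ PerfectSets → M ⊆ Q → Blk Ls Y.1 0 X.1 →
      FBlk Ls X.1 j b → ∃ M' ∈ PerfectSets, M' ⊆ M ∧ ∃ X', Ext Ls j X' X ∧ D i b j M' X')
    {A : List Bool → Set (ℕ → Bool)} (hA : ∀ σ, A σ ∈ PerfectSets ∧ A σ ⊆ Q)
    {X : VarWordSeq L} (hX : Blk Ls Y.1 0 X.1) (T : Finset (List Bool × ℕ × List (List L)))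
    (hT : ∀ τ ∈ T, FBlk Ls X.1 j τ.2.2) :
    ∃ A' : List Bool → Set (ℕ → Bool), (∀ σ, A' σ ∈ PerfectSets ∧ A' σ ⊆ A σ) ∧
      ∃ X', Ext Ls j X' X ∧ ∀ τ ∈ T, D τ.2.1 τ.2.2 j (A' τ.1) X' := by
  classical
  induction T using Finset.induction_on with
  | empty => exact ⟨A, fun σ => ⟨(hA σ).1, subset_rfl⟩, X, Ext.refl _ _ _, by simp⟩
  | insert τ T _ ih =>
    obtain ⟨A', hA', X', hX', hD⟩ := ih fun τ hτ => hT τ (Finset.mem_insert_of_mem hτ)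
    obtain ⟨M, hM, hMA, X'', hX'', hDM⟩ := hdense τ.2.1 τ.2.2 (A' τ.1) X' (hA' τ.1).1
      ((hA' τ.1).2.trans (hA τ.1).2) (hX'.1.trans hmono hX)
      ((hT τ (Finset.mem_insert_self _ _)).congr fun n hn => (hX'.2 n hn).symm)
    have hsub : ∀ σ, Function.update A' τ.1 M σ ⊆ A' σ := by
      intro σ
      by_cases h : σ = τ.1
      · subst h
        simpa using hMA
      · simp [h]
    refine ⟨Function.update A' τ.1 M, fun σ => ⟨?_, (hsub σ).trans (hA' σ).2⟩, X'',
      hX''.trans hmono hX' le_rfl, fun ρ hρ => ?_⟩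
    · by_cases h : σ = τ.1
      · subst h
        simpa using hM
      · simpa [h] using (hA' σ).1
    · rcases Finset.mem_insert.1 hρ with rfl | hρ
      · simpa using hDM
      · exact hered _ _ _ _ _ _ _ (hsub _) hX''.1 (hD ρ hρ)

/-- Fusion: countably many hereditary dense requirements can be met simultaneously. -/
theorem fusion {Ls : ℕ → Finset L} (hmono : Monotone Ls)
    {D : ℕ → List (List L) → ℕ → Set (ℕ → Bool) → VarWordSeq L → Prop}
    {Q : Set (ℕ → Bool)} (hQ : Q ∈ PerfectSets) {Y : VarWordSeq L} {m : ℕ}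
    (hered : ∀ i b j M M' X X', M' ⊆ M → Blk Ls X.1 0 X'.1 → D i b j M X → D i b j M' X')
    (hdense : ∀ i b j M X, M ∈ PerfectSets → M ⊆ Q → Blk Ls Y.1 0 X.1 → m ≤ j →
      FBlk Ls X.1 j b → ∃ M' ∈ PerfectSets, M' ⊆ M ∧ ∃ X', Ext Ls j X' X ∧ D i b j M' X') :
    ∃ M ∈ PerfectSets, M ⊆ Q ∧ ∃ X, Ext Ls m X Y ∧ ∀ k, m ≤ k → ∀ i ≤ k, ∀ b,
      FBlk Ls X.1 k b → ∀ x ∈ M, ∃ V, IsOpen V ∧ x ∈ V ∧ D i b k (M ∩ V) X := by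
  classical
  -- Only the pieces indexed by lists of length `k` matter at stage `k`; values at other lists are
  -- filler.
  let St := (List Bool → Set (ℕ → Bool)) × VarWordSeq L
  let Inv : ℕ → St → Prop := fun _ s =>
    (∀ σ, s.1 σ ∈ PerfectSets ∧ s.1 σ ⊆ Q) ∧ Blk Ls Y.1 0 s.2.1
  let Rel : ℕ → St → St → Prop := fun k s s' => Ext Ls (m + k) s'.2 s.2 ∧
    (∀ b σ, s'.1 (b :: σ) ⊆ s.1 σ) ∧ (∀ σ, Disjoint (s'.1 (true :: σ)) (s'.1 (false :: σ))) ∧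
    (∀ b σ, ∀ x ∈ s'.1 (b :: σ), ∀ y ∈ s'.1 (b :: σ), ∀ i < σ.length, x i = y i) ∧
    ∀ c σ, σ.length = k → ∀ i ≤ m + k, ∀ b, FBlk Ls s'.2.1 (m + k) b →
      D i b (m + k) (s'.1 (c :: σ)) s'.2
  obtain ⟨S, hS0, hS⟩ := exists_seq_of_step Inv Rel (fun _ => Q, Y)
    ⟨fun _ => ⟨hQ, subset_rfl⟩, Blk.refl _ _⟩ (by
    rintro k ⟨A, X⟩ ⟨hA, hX⟩
    have hfin := finite_setOf_fblk hmono X.1 (m + k)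
    obtain ⟨A', hA', X', hX', hD⟩ := exists_decide_finset hmono hered
      (fun i b M X h1 h2 h3 => hdense i b (m + k) M X h1 h2 h3 (Nat.le_add_right m k)) hA hX
      ((List.finite_length_eq Bool k).toFinset ×ˢ (Finset.range (m + k + 1) ×ˢ hfin.toFinset))
      (fun τ hτ => by
        simp only [Finset.mem_product, Set.Finite.mem_toFinset] at hτ
        exact hτ.2.2)
    choose P hP hPd hPc using fun σ => exists_disjoint_perfect (hA' σ).1 σ.length
    refine ⟨(fun σ => match σ with
      | [] => Q
      | b :: σ => P σ b, X'), ⟨fun σ => ?_, hX'.1.trans hmono hX⟩, hX', ?_, hPd,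
      fun b σ => hPc σ b, ?_⟩
    · match σ with
      | [] => exact ⟨hQ, subset_rfl⟩
      | b :: σ => exact ⟨(hP σ b).1, (hP σ b).2.trans ((hA' σ).2.trans (hA σ).2)⟩
    · exact fun b σ => (hP σ b).2.trans (hA' σ).2
    · intro c σ hσ i hi b hb
      refine hered i b (m + k) _ _ _ _ (hP σ c).2 (Blk.refl _ _) (hD (σ, i, b) ?_)
      simp only [Finset.mem_product, Set.Finite.mem_toFinset, Finset.mem_range]
      exact ⟨hσ, by omega, hb.congr hX'.2⟩)
  obtain ⟨X, hX⟩ := exists_fusion_limit hmono (fun k => (S k).2) fun k => (hS k).2.1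
  obtain ⟨M, hM, hMQ, hMs⟩ := exists_perfect_of_scheme (fun σ => (S σ.length).1 σ)
    (fun σ => ((hS _).1.1 σ).1.1.closed) (fun σ => ((hS _).1.1 σ).1.2)
    (fun b σ => (hS _).2.2.1 b σ) (fun σ => (hS _).2.2.2.1 σ) (fun b σ => (hS _).2.2.2.2.1 b σ)
  refine ⟨M, hM, ?_, X, ?_, ?_⟩
  · exact hMQ.trans ((hS 0).1.1 []).2
  · have h := hX 0
    rw [hS0] at h
    exact h
  · intro k hk i hi b hb x hx
    obtain ⟨k, rfl⟩ := Nat.exists_eq_add_of_le hk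
    -- Requirements at cut `m + k` were met on the pieces created at the next level, hence `k + 1`.
    obtain ⟨σ, hσ, V, hV, hxV, hMV⟩ := hMs (k + 1) x hx
    refine ⟨V, hV, hxV, ?_⟩
    cases σ with
    | nil => simp at hσ
    | cons c σ =>
      have hσ' : σ.length = k := by simpa using hσ
      rw [hσ] at hMV
      have hb' : FBlk Ls (S (k + 1)).2.1 (m + k) b :=
        hb.congr fun n hn => (hX (k + 1)).2 n (by omega)
      exact hered _ _ _ _ _ _ _ hMV (hX (k + 1)).1 ((hS k).2.2.2.2.2 c σ hσ' i hi b hb')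

/-! ### Combinatorial forcing and open sets -/

/-- No refinement of `(M, X)` has its neighbourhood of `b` inside `Z`. -/
def Rej (Ls : ℕ → Finset L) (M : Set (ℕ → Bool)) (b : List (List L)) (X : VarWordSeq L)
    (Z : Set ((ℕ → Bool) × WordSeq L)) : Prop :=
  ∀ M' ∈ PerfectSets, M' ⊆ M → ∀ X' : VarWordSeq L, Blk Ls X.1 0 X'.1 →
    ∀ m, ¬ M' ×ˢ nbhd Ls b m X' ⊆ Z

/-- Every neighbourhood below `(M₀, X₀)` can be refined to be inside `Lam` or disjoint from it. -/
def RamBelow (Ls : ℕ → Finset L) (M₀ : Set (ℕ → Bool)) (X₀ : VarWordSeq L)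
    (Lam : Set ((ℕ → Bool) × WordSeq L)) : Prop :=
  ∀ M ∈ PerfectSets, M ⊆ M₀ → ∀ X : VarWordSeq L, Blk Ls X₀.1 0 X.1 → ∀ b j, FBlk Ls X.1 j b →
    ∃ M' ∈ PerfectSets, M' ⊆ M ∧ ∃ X', Ext Ls j X' X ∧
      (M' ×ˢ nbhd Ls b j X' ⊆ Lam ∨ M' ×ˢ nbhd Ls b j X' ⊆ Lamᶜ)

theorem Rej.mono {Ls : ℕ → Finset L} (hmono : Monotone Ls) {M M' : Set (ℕ → Bool)}
    {b : List (List L)} {X X' : VarWordSeq L} {Z : Set ((ℕ → Bool) × WordSeq L)}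
    (h : Rej Ls M b X Z) (hM : M' ⊆ M) (hX : Blk Ls X.1 0 X'.1) : Rej Ls M' b X' Z :=
  fun P hP hPM X'' hX'' => h P hP (hPM.trans hM) X'' (hX''.trans hmono hX)

/-- Deciding is dense: a pair that does not reject has a refinement inside `Z i`, and
`exists_ext_nbhd` grafts its tail onto the first `j` terms. Fusion then decides all approximations.
-/
theorem exists_decided {Ls : ℕ → Finset L} (hmono : Monotone Ls)
    (Z : ℕ → Set ((ℕ → Bool) × WordSeq L)) {Q : Set (ℕ → Bool)} (hQ : Q ∈ PerfectSets)
    (Y : VarWordSeq L) (m : ℕ) :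
    ∃ M ∈ PerfectSets, M ⊆ Q ∧ ∃ X, Ext Ls m X Y ∧ ∀ k, m ≤ k → ∀ i ≤ k, ∀ b,
      FBlk Ls X.1 k b → ∀ x ∈ M, ∃ V, IsOpen V ∧ x ∈ V ∧
        ((M ∩ V) ×ˢ nbhd Ls b k X ⊆ Z i ∨ Rej Ls (M ∩ V) b X (Z i)) := by
  refine fusion hmono
    (D := fun i b j M X => M ×ˢ nbhd Ls b j X ⊆ Z i ∨ Rej Ls M b X (Z i)) hQ ?_ ?_
  · rintro i b j M M' X X' hM hX (h | h)
    · exact Or.inl ((Set.prod_mono hM (nbhd_mono hmono hX b j)).trans h)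
    · exact Or.inr (h.mono hmono hM hX)
  · intro i b j M X hM hMQ hX _ _
    by_cases h : Rej Ls M b X (Z i)
    · exact ⟨M, hM, subset_rfl, X, Ext.refl _ _ _, Or.inr h⟩
    · simp only [Rej, not_forall, not_not] at h
      obtain ⟨M', hM', hMM, X', hX', k, hk⟩ := h
      obtain ⟨X'', hX'', hsub⟩ := exists_ext_nbhd hmono hX' j k
      exact ⟨M', hM', hMM, X'', hX'', Or.inl ((Set.prod_mono subset_rfl (hsub b)).trans hk)⟩

theorem nbhd_trans {Ls : ℕ → Finset L} (hmono : Monotone Ls) {X Y : VarWordSeq L} {j : ℕ}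
    {b : List (List L)} (hb : FBlk Ls X.1 j b) (hXY : Blk Ls Y.1 0 X.1) :
    ∃ k, j ≤ k ∧ FBlk Ls Y.1 k b ∧ nbhd Ls b j X ⊆ nbhd Ls b k Y := by
  obtain ⟨k, hk, hb', h⟩ := hb.trans hmono hXY
  exact ⟨k, hk, hb', fun A hA => ⟨hA.1, h _ hA.2⟩⟩

/-- Sets that are open in the sense of the neighbourhoods below `(Q, Y)` are Ramsey. -/
theorem exists_ext_of_open {Ls : ℕ → Finset L} (hmono : Monotone Ls)
    (hunion : ∀ l : L, ∃ n, l ∈ Ls n) [Nonempty L]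
    {U : Set ((ℕ → Bool) × WordSeq L)} {Q : Set (ℕ → Bool)} (hQ : Q ∈ PerfectSets)
    {Y : VarWordSeq L} {a : List (List L)} {m : ℕ} (ha : FBlk Ls Y.1 m a)
    (hU : ∀ x ∈ Q, ∀ A ∈ nbhd Ls a m Y, (x, A) ∈ U → ∃ V, IsOpen V ∧ x ∈ V ∧
      ∃ n, a.length ≤ n ∧ ∃ k, (Q ∩ V) ×ˢ nbhd Ls (r n A) k Y ⊆ U) :
    ∃ M ∈ PerfectSets, M ⊆ Q ∧ ∃ X, Ext Ls m X Y ∧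
      (M ×ˢ nbhd Ls a m X ⊆ U ∨ M ×ˢ nbhd Ls a m X ⊆ Uᶜ) := by
  obtain ⟨M₁, hM₁, hM₁Q, X₁, hX₁, hdec⟩ := exists_decided hmono (fun _ => U) hQ Y m
  replace hdec : ∀ k, m ≤ k → ∀ b, FBlk Ls X₁.1 k b → ∀ x ∈ M₁, ∃ V, IsOpen V ∧ x ∈ V ∧
      ((M₁ ∩ V) ×ˢ nbhd Ls b k X₁ ⊆ U ∨ Rej Ls (M₁ ∩ V) b X₁ U) :=
    fun k hk b hb x hx => hdec k hk 0 (Nat.zero_le _) b hb x hx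
  let rej : (ℕ → Bool) → List (List L) → Prop := fun x b =>
    ∃ V, IsOpen V ∧ x ∈ V ∧ Rej Ls (M₁ ∩ V) b X₁ U
  have hacc : ∀ {M X b k}, M ∈ PerfectSets → M ⊆ M₁ → Blk Ls X₁.1 0 X.1 →
      M ×ˢ nbhd Ls b k X ⊆ U → ∀ x ∈ M, ¬ rej x b := by
    rintro M X b k hM hMM hX h x hx ⟨V, hV, hxV, hR⟩
    obtain ⟨P, hP, hPM⟩ := exists_perfect_subset_inter hM.1 hV ⟨x, hx, hxV⟩
    exact hR P hP (hPM.trans (Set.inter_subset_inter_left _ hMM)) X hX k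
      ((Set.prod_mono (hPM.trans Set.inter_subset_left) subset_rfl).trans h)
  have hacc' : ∀ {V b k}, IsOpen V → (M₁ ∩ V) ×ˢ nbhd Ls b k X₁ ⊆ U →
      ∀ x ∈ M₁ ∩ V, ¬ rej x b := by
    rintro V b k hV h x hx
    obtain ⟨i, hi⟩ := exists_cyl_subset hV hx.2
    exact hacc ⟨perfect_inter_clopen hM₁.1 (isClopen_cyl x i), x, hx.1, mem_cyl_self x i⟩
      Set.inter_subset_left (Blk.refl _ _)
      ((Set.prod_mono (Set.inter_subset_inter_right _ hi) subset_rfl).trans h) x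
      ⟨hx.1, mem_cyl_self x i⟩
  -- If some point fails to reject `a`, its decided neighbourhood lies inside `U`. The rest treats
  -- the case where every point rejects `a`.
  by_cases hrej : ∀ x ∈ M₁, rej x a
  swap
  · push Not at hrej
    obtain ⟨x, hx, hxr⟩ := hrej
    obtain ⟨V, hV, hxV, h | h⟩ := hdec m le_rfl a
      (ha.congr fun n hn => (hX₁.2 n hn).symm) x hx
    · obtain ⟨P, hP, hPM⟩ := exists_perfect_subset_inter hM₁.1 hV ⟨x, hx, hxV⟩
      exact ⟨P, hP, (hPM.trans Set.inter_subset_left).trans hM₁Q, X₁, hX₁,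
        Or.inl ((Set.prod_mono hPM subset_rfl).trans h)⟩
    · exact absurd ⟨V, hV, hxV, h⟩ hxr
  obtain ⟨M₂, hM₂, hM₂M, X₂, hX₂, hfus⟩ := fusion hmono (Q := M₁) (Y := X₁) (m := m)
    (D := fun _ b j M X =>
      (∀ x ∈ M, ∀ t w, Loc Ls j t → w.map some = ev X.1 t → rej x (b ++ [w])) ∨
        ∀ x ∈ M, ¬ rej x b) hM₁ (by
      rintro _ b j M M' X X' hM ⟨σ, hσ, hσb⟩ (h | h)
      · refine Or.inl fun x hx t w ht hw => h x (hM hx) (bind σ t) w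
          (ht.bind hmono (fun n => (hσ n).1) hσb) ?_
        rw [hw]
        exact ev_bind fun p _ => (hσ p.1).2
      · exact Or.inr fun x hx => h x (hM hx)) (by
    intro _ b j M X hM hMM hX hmj hb
    by_cases hall : ∀ x ∈ M, rej x b
    swap
    · push Not at hall
      obtain ⟨x, hx, hxr⟩ := hall
      obtain ⟨k, hk, hbk, -⟩ := hb.trans hmono hX
      obtain ⟨V, hV, hxV, h | h⟩ := hdec k (hmj.trans hk) b hbk x (hMM hx)
      · obtain ⟨P, hP, hPM⟩ := exists_perfect_subset_inter hM.1 hV ⟨x, hx, hxV⟩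
        exact ⟨P, hP, hPM.trans Set.inter_subset_left, X, Ext.refl _ _ _,
          Or.inr fun y hy => hacc' hV h y ⟨hMM (hPM hy).1, (hPM hy).2⟩⟩
      · exact absurd ⟨V, hV, hxV, h⟩ hxr
    -- Rejection of `b ++ [w]` is locally constant because `X₁` decides it near every point.
    obtain ⟨M', hM', hM'M, X', hX', h | h⟩ := pigeonhole hmono hunion hM X j
      (fun x w => rej x (b ++ [w])) (by
        intro w t ht hw x hx
        obtain ⟨k, hk, htk⟩ := exists_lt_of_list t j
        obtain ⟨k', hk', hbk, -⟩ := (hb.append ht htk hw).trans hmono hX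
        obtain ⟨V, hV, hxV, h | h⟩ := hdec k' (hmj.trans (hk.trans hk')) _ hbk x (hMM hx)
        · refine ⟨V, hV, hxV, fun y hy => iff_of_false ?_ ?_⟩
          · exact hacc' hV h y ⟨hMM hy.1, hy.2⟩
          · exact hacc' hV h x ⟨hMM hx, hxV⟩
        · exact ⟨V, hV, hxV, fun y hy => iff_of_true ⟨V, hV, hy.2, h⟩ ⟨V, hV, hxV, h⟩⟩)
    · exact ⟨M', hM', hM'M, X', hX', Or.inl h⟩
    -- If no one-word extension were rejected, all would be accepted by `X₁`, and together they
    -- would put the neighbourhood of `b` inside `U`, although `b` is rejected.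
    · exfalso
      obtain ⟨x, hx⟩ := hM'.2
      have hX'₁ := hX'.1.trans hmono hX
      refine hacc (k := j) hM' (hM'M.trans hMM) hX'₁ ?_ x hx (hall x (hM'M hx))
      rintro ⟨y, A⟩ ⟨hy, hA⟩
      obtain ⟨k, hk, hAk, t, ht, htk, hw⟩ := exists_step hA
      have hbX' : FBlk Ls X'.1 j b := hb.congr fun n hn => (hX'.2 n hn).symm
      obtain ⟨k', hk', hbk', hsub⟩ := nbhd_trans hmono (hbX'.append ht htk hw) hX'₁
      obtain ⟨V, hV, hyV, h' | h'⟩ := hdec k' (by omega) _ hbk' y (hMM (hM'M hy))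
      · exact h' ⟨⟨hMM (hM'M hy), hyV⟩, hsub hAk⟩
      · exact (h y hy t _ ht hw ⟨V, hV, hyV, h'⟩).elim)
  refine ⟨M₂, hM₂, hM₂M.trans hM₁Q, X₂, hX₂.trans hmono hX₁ le_rfl, Or.inr ?_⟩
  rintro ⟨x, A⟩ ⟨hx, hA⟩ hxA
  have hXY : Blk Ls Y.1 0 X₂.1 := hX₂.1.trans hmono hX₁.1
  have haX₂ : FBlk Ls X₂.1 m a :=
    ha.congr fun n hn => ((hX₂.2 n hn).trans (hX₁.2 n hn)).symm
  -- Rejection propagates along `A`; a point of `U` would have, by openness, an approximation whose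
  -- neighbourhood lies in `U`.
  have hind : ∀ n, rej x (r (a.length + n) A) := by
    intro n
    induction n with
    | zero =>
      rw [add_zero, hA.1]
      exact hrej x (hM₂M hx)
    | succ n ih =>
      obtain ⟨k, hk, hAk, -, hb⟩ := exists_split hA n
      obtain ⟨V, hV, hxV, h | h⟩ := hfus k (by omega) 0 (Nat.zero_le _) _ (hb haX₂) x hx
      · obtain ⟨k', -, -, t, ht, -, hw⟩ := exists_step hAk
        have := h x ⟨hx, hxV⟩ t _ ht hw
        rwa [length_r, ← r_succ] at this
      · exact absurd ih (h x ⟨hx, hxV⟩)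
  obtain ⟨V, hV, hxV, n, hn, k, hk⟩ := hU x (hM₁Q (hM₂M hx)) A (nbhd_mono hmono hXY a m hA) hxA
  obtain ⟨d, rfl⟩ := Nat.exists_eq_add_of_le hn
  obtain ⟨V', hV', hxV', hR⟩ := hind d
  obtain ⟨P, hP, hPM⟩ := exists_perfect_subset_inter hM₂.1 (hV.inter hV') ⟨x, hx, hxV, hxV'⟩
  have hPM₁ : P ⊆ M₁ ∩ V' := fun y hy => ⟨hM₂M (hPM hy).1, (hPM hy).2.2⟩
  have hPQ : P ⊆ Q ∩ V := fun y hy => ⟨hM₁Q (hM₂M (hPM hy).1), (hPM hy).2.1⟩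
  exact hR P hP hPM₁ X₂ hX₂.1 k ((Set.prod_mono hPQ (nbhd_mono hmono hXY _ k)).trans hk)

/-! ### Complements and countable unions -/

theorem RamBelow.compl {Ls : ℕ → Finset L} {M₀ : Set (ℕ → Bool)} {X₀ : VarWordSeq L}
    {Lam : Set ((ℕ → Bool) × WordSeq L)} (h : RamBelow Ls M₀ X₀ Lam) :
    RamBelow Ls M₀ X₀ Lamᶜ := by
  intro M hM hMM X hX b j hb
  obtain ⟨M', hM', hMM', X', hX', h⟩ := h M hM hMM X hX b j hb
  exact ⟨M', hM', hMM', X', hX', by rw [compl_compl]; exact h.symm⟩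

/-- After fusion every `Lam i` is decided near each point at late enough approximations. A point of
`Lam i` then has a neighbourhood inside `Lam i`, so the union is open and `exists_ext_of_open`
applies. -/
theorem RamBelow.iUnion {Ls : ℕ → Finset L} (hmono : Monotone Ls)
    (hunion : ∀ l : L, ∃ n, l ∈ Ls n) [Nonempty L] {M₀ : Set (ℕ → Bool)} {X₀ : VarWordSeq L}
    {Lam : ℕ → Set ((ℕ → Bool) × WordSeq L)} (h : ∀ i, RamBelow Ls M₀ X₀ (Lam i)) :
    RamBelow Ls M₀ X₀ (⋃ i, Lam i) := by
  intro M hM hMM X hX b j hb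
  obtain ⟨M₁, hM₁, hM₁M, X₁, hX₁, hdec⟩ := fusion hmono (Q := M) (Y := X) (m := j)
    (D := fun i b j M X => M ×ˢ nbhd Ls b j X ⊆ Lam i ∨ M ×ˢ nbhd Ls b j X ⊆ (Lam i)ᶜ) hM (by
      rintro i b j M M' X X' hM hX h
      exact h.imp (Set.prod_mono hM (nbhd_mono hmono hX b j)).trans
        (Set.prod_mono hM (nbhd_mono hmono hX b j)).trans)
    fun i b j M' X' hM' hM'M hX' _ hb =>
      h i M' hM' (hM'M.trans hMM) X' (hX'.trans hmono hX) b j hb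
  have hb₁ : FBlk Ls X₁.1 j b := hb.congr fun n hn => (hX₁.2 n hn).symm
  obtain ⟨M₂, hM₂, hM₂M, X₂, hX₂, h⟩ := exists_ext_of_open hmono hunion (U := ⋃ i, Lam i)
    hM₁ hb₁ (by
      intro x hx A hA hxA
      obtain ⟨i, hi⟩ := Set.mem_iUnion.1 hxA
      obtain ⟨k, hk, hAk, -, hbk⟩ := exists_split hA i
      obtain ⟨V, hV, hxV, h | h⟩ := hdec k (by omega) i (by omega) _ (hbk hb₁) x hx
      · exact ⟨V, hV, hxV, _, Nat.le_add_right _ i, k, h.trans (Set.subset_iUnion _ i)⟩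
      · exact absurd hi (h ⟨⟨hx, hxV⟩, hAk⟩))
  exact ⟨M₂, hM₂, hM₂M.trans hM₁M, X₂, hX₂.trans hmono hX₁ le_rfl, h⟩

theorem RamBelow.iUnion_of_countable {Ls : ℕ → Finset L} (hmono : Monotone Ls)
    (hunion : ∀ l : L, ∃ n, l ∈ Ls n) [Nonempty L] {M₀ : Set (ℕ → Bool)} {X₀ : VarWordSeq L}
    {ι : Type*} [Countable ι] [Nonempty ι] {Lam : ι → Set ((ℕ → Bool) × WordSeq L)}
    (h : ∀ i, RamBelow Ls M₀ X₀ (Lam i)) : RamBelow Ls M₀ X₀ (⋃ i, Lam i) := by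
  obtain ⟨e, he⟩ := exists_surjective_nat ι
  rw [← he.iUnion_comp]
  exact RamBelow.iUnion hmono hunion fun i => h (e i)

theorem RamBelow.union {Ls : ℕ → Finset L} (hmono : Monotone Ls)
    (hunion : ∀ l : L, ∃ n, l ∈ Ls n) [Nonempty L] {M₀ : Set (ℕ → Bool)} {X₀ : VarWordSeq L}
    {S T : Set ((ℕ → Bool) × WordSeq L)} (hS : RamBelow Ls M₀ X₀ S)
    (hT : RamBelow Ls M₀ X₀ T) : RamBelow Ls M₀ X₀ (S ∪ T) := by
  rw [Set.union_eq_iUnion]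
  exact RamBelow.iUnion_of_countable hmono hunion fun b => by cases b <;> assumption

theorem RamBelow.inter {Ls : ℕ → Finset L} (hmono : Monotone Ls)
    (hunion : ∀ l : L, ∃ n, l ∈ Ls n) [Nonempty L] {M₀ : Set (ℕ → Bool)} {X₀ : VarWordSeq L}
    {S T : Set ((ℕ → Bool) × WordSeq L)} (hS : RamBelow Ls M₀ X₀ S)
    (hT : RamBelow Ls M₀ X₀ T) : RamBelow Ls M₀ X₀ (S ∩ T) := by
  rw [← compl_compl (S ∩ T), Set.compl_inter]
  exact (RamBelow.union hmono hunion hS.compl hT.compl).compl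

/-! ### The Souslin operation -/

/-- The interior of `Z` with respect to the neighbourhoods given by `(M₀, X₀)`. -/
def interiorOf (Ls : ℕ → Finset L) (M₀ : Set (ℕ → Bool)) (X₀ : VarWordSeq L)
    (Z : Set ((ℕ → Bool) × WordSeq L)) : Set ((ℕ → Bool) × WordSeq L) :=
  {z | ∃ V, IsOpen V ∧ z.1 ∈ V ∧ ∃ n k, z.2 ∈ nbhd Ls (r n z.2) k X₀ ∧
    (M₀ ∩ V) ×ˢ nbhd Ls (r n z.2) k X₀ ⊆ Z}

theorem ramBelow_interiorOf {Ls : ℕ → Finset L} (hmono : Monotone Ls)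
    (hunion : ∀ l : L, ∃ n, l ∈ Ls n) [Nonempty L] (M₀ : Set (ℕ → Bool)) (X₀ : VarWordSeq L)
    (Z : Set ((ℕ → Bool) × WordSeq L)) : RamBelow Ls M₀ X₀ (interiorOf Ls M₀ X₀ Z) := by
  intro M hM hMM X hX b j hb
  refine exists_ext_of_open hmono hunion hM hb ?_
  rintro x hx A hA ⟨V, hV, hxV, n, k, hAk, hsub⟩
  obtain ⟨k', -, -, hsub', -⟩ := exists_split hAk b.length
  rw [length_r] at hsub'
  refine ⟨V, hV, hxV, n + b.length, Nat.le_add_left _ _, k', ?_⟩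
  rintro ⟨x', A'⟩ ⟨⟨hx', hxV'⟩, hA'⟩
  have h := hsub' (nbhd_mono hmono hX _ _ hA')
  have hr : r n A' = r n A := by
    have := h.1
    rwa [length_r] at this
  exact ⟨V, hV, hxV', n, k, by dsimp only; rwa [hr], by dsimp only; rwa [hr]⟩

/-- The part of the result of the Souslin operation coming from the branches through `c`. -/
def souslinAt {β : Type*} (Lam : List (List L) → Set β) (c : List (List L)) : Set β :=
  {z | ∃ A : WordSeq L, r c.length A = c ∧ ∀ n, z ∈ Lam (r n A)}

theorem souslinAt_nil {β : Type*} (Lam : List (List L) → Set β) :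
    souslinAt Lam [] = souslin Lam := by
  ext z
  simp [souslinAt, souslin, r]

theorem souslinAt_subset {β : Type*} (Lam : List (List L) → Set β) (c : List (List L)) :
    souslinAt Lam c ⊆ Lam c := by
  rintro z ⟨A, hA, h⟩
  rw [← hA]
  exact h _

theorem souslinAt_subset_iUnion {β : Type*} (Lam : List (List L) → Set β) (c : List (List L)) :
    souslinAt Lam c ⊆ ⋃ w, souslinAt Lam (c ++ [w]) := by
  rintro z ⟨A, hA, h⟩
  refine Set.mem_iUnion.2 ⟨A.1 c.length, A, ?_, h⟩
  rw [List.length_append, List.length_singleton, r_succ, hA]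

/-- Rapid increase at `n` concerns only the first `n + 1` words, and these begin a rapidly
increasing sequence by `hAR`. -/
theorem exists_wordSeq_of_branch (c : ℕ → List (List L)) (w : ℕ → List L) (hc0 : c 0 = [])
    (hc : ∀ n, c (n + 1) = c n ++ [w n]) (hAR : ∀ n, c n ∈ AR L) :
    ∃ A : WordSeq L, ∀ n, r n A = c n := by
  have hcw : ∀ n, c n = (List.range n).map w := by
    intro n
    induction n with
    | zero => simpa using hc0
    | succ n ih => rw [hc, ih, List.range_succ, List.map_append, List.map_singleton]
  refine ⟨⟨w, fun n => ?_⟩, fun n => (hcw n).symm⟩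
  obtain ⟨B, k, hB⟩ := hAR (n + 1)
  have hk : k = n + 1 := by
    have := congrArg List.length hB
    rwa [length_r, hcw, List.length_map, List.length_range] at this
  subst hk
  rw [hcw, r, List.map_inj_left] at hB
  have hBw : ∀ i ≤ n, B.1 i = w i := fun i hi => hB i (List.mem_range.2 (by omega))
  rw [← hBw n le_rfl, Finset.sum_congr rfl fun i hi => by
    rw [← hBw i (Finset.mem_range.1 hi).le]]
  exact B.2 n

/-- Over `M₀` the hull `Ψ c` lies between `souslinAt Lam c` and `Lam c`, and it is nearly least: a
Ramsey set covering `souslinAt Lam c` covers `Ψ c` up to a negligible set. So `Ψ c` is negligibly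
larger than the union of the hulls of its successors. -/
theorem ramBelow_souslin {Ls : ℕ → Finset L} (hmono : Monotone Ls)
    (hunion : ∀ l : L, ∃ n, l ∈ Ls n) [Nonempty L]
    {Lam : List (List L) → Set ((ℕ → Bool) × WordSeq L)}
    (hLam : ∀ c M X, RamBelow Ls M X (Lam c)) (hAR : ∀ c ∉ AR L, Lam c = ∅)
    (M : Set (ℕ → Bool)) (X : VarWordSeq L) : RamBelow Ls M X (souslin Lam) := by
  have := countable_of_union hunion
  intro Q hQ _ Y _ a m ha
  obtain ⟨e, he⟩ := exists_surjective_nat (List (List L))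
  obtain ⟨M₀, hM₀, hM₀Q, X₀, hX₀, hdec⟩ :=
    exists_decided hmono (fun i => (souslinAt Lam (e i))ᶜ) hQ Y m
  let O : List (List L) → Set ((ℕ → Bool) × WordSeq L) := fun c =>
    interiorOf Ls M₀ X₀ (souslinAt Lam c)ᶜ
  let Ψ : List (List L) → Set ((ℕ → Bool) × WordSeq L) := fun c => (O c)ᶜ ∩ Lam c
  have hΨ : ∀ c, RamBelow Ls M₀ X₀ (Ψ c) := fun c =>
    RamBelow.inter hmono hunion (ramBelow_interiorOf hmono hunion M₀ X₀ _).compl (hLam c M₀ X₀)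
  have hsub : ∀ c z, z.1 ∈ M₀ → z ∈ souslinAt Lam c → z ∈ Ψ c := by
    refine fun c z hz hzc => ⟨?_, souslinAt_subset Lam c hzc⟩
    rintro ⟨V, hV, hzV, n, k, hA, h⟩
    exact h (Set.mk_mem_prod ⟨hz, hzV⟩ hA) hzc
  let N : List (List L) → Set ((ℕ → Bool) × WordSeq L) := fun c =>
    Ψ c \ ⋃ w, Ψ (c ++ [w])
  have hN : ∀ c, ∀ M ∈ PerfectSets, M ⊆ M₀ → ∀ X : VarWordSeq L, Blk Ls X₀.1 0 X.1 →
      ∀ b j, FBlk Ls X.1 j b → ∃ M' ∈ PerfectSets, M' ⊆ M ∧ ∃ X', Ext Ls j X' X ∧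
        M' ×ˢ nbhd Ls b j X' ⊆ (N c)ᶜ := by
    intro c M hM hMM X hX b j hb
    obtain ⟨M', hM', hM'M, X', hX', h | h⟩ :=
      RamBelow.iUnion_of_countable hmono hunion (fun w => hΨ (c ++ [w])) M hM hMM X hX b j hb
    · exact ⟨M', hM', hM'M, X', hX', fun z hz hzN => hzN.2 (h hz)⟩
    · refine ⟨M', hM', hM'M, X', hX', ?_⟩
      rintro ⟨x, A⟩ ⟨hx, hA⟩ hzN
      obtain ⟨i, rfl⟩ := he c
      have hX'₀ := hX'.1.trans hmono hX
      have hxM := hMM (hM'M hx)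
      -- `i + m` further words push the cut past both `i` and `m`, where `hdec` applies.
      obtain ⟨k, hk, hAk, hkj, hbk⟩ := exists_split hA (i + m)
      obtain ⟨k₀, hk₀, hbk₀, hsub₀⟩ := nbhd_trans hmono
        (hbk (hb.congr fun n hn => (hX'.2 n hn).symm)) hX'₀
      obtain ⟨V, hV, hxV, hd | hd⟩ := hdec k₀ (by omega) i (by omega) _ hbk₀ x hxM
      · exact hzN.1.1 ⟨V, hV, hxV, _, k₀, hsub₀ hAk, hd⟩
      -- Here no refinement avoids `souslinAt Lam c`. Yet `M' ×ˢ nbhd Ls b j X'` misses all the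
      -- hulls `Ψ (c ++ [w])`, which cover `souslinAt Lam c` over `M₀`.
      · obtain ⟨P, hP, hPM⟩ := exists_perfect_subset_inter hM'.1 hV ⟨x, hx, hxV⟩
        have hPM₀ : P ⊆ M₀ ∩ V := fun y hy => ⟨hMM (hM'M (hPM hy).1), (hPM hy).2⟩
        refine hd P hP hPM₀ X' hX'₀ k fun z hz hzS => ?_
        refine h ⟨(hPM hz.1).1, hkj hz.2⟩ ?_
        obtain ⟨w, hw⟩ := Set.mem_iUnion.1 (souslinAt_subset_iUnion Lam _ hzS)
        exact Set.mem_iUnion.2 ⟨w, hsub _ z (hPM₀ hz.1).1 hw⟩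
  obtain ⟨M₁, hM₁, hM₁M, X₁, hX₁, hΨ₁⟩ := hΨ [] M₀ hM₀ subset_rfl X₀ (Blk.refl _ _) a m
    (ha.congr fun n hn => (hX₀.2 n hn).symm)
  obtain ⟨M₂, hM₂, hM₂M, X₂, hX₂, hN₂⟩ := fusion hmono (Q := M₁) (Y := X₁) (m := m)
    (D := fun i b j M X => M ×ˢ nbhd Ls b j X ⊆ (N (e i))ᶜ) hM₁
    (fun i b j M M' X X' hM hX h => (Set.prod_mono hM (nbhd_mono hmono hX b j)).trans h)
    fun i b j M X hM hMM hX _ hb =>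
      hN (e i) M hM (hMM.trans hM₁M) X (hX.trans hmono hX₁.1) b j hb
  have hX₂Y := (hX₂.trans hmono hX₁ le_rfl).trans hmono hX₀ le_rfl
  have hN₃ : ∀ z ∈ M₂ ×ˢ nbhd Ls a m X₂, ∀ c, z ∉ N c := by
    rintro ⟨x, A⟩ ⟨hx, hA⟩ c
    obtain ⟨i, rfl⟩ := he c
    obtain ⟨k, hk, hAk, -, hak⟩ := exists_split hA i
    obtain ⟨V, hV, hxV, h⟩ := hN₂ k (by omega) i (by omega) _
      (hak (ha.congr fun n hn => (hX₂Y.2 n hn).symm)) x hx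
    exact h ⟨⟨hx, hxV⟩, hAk⟩
  have hsub₁ : M₂ ×ˢ nbhd Ls a m X₂ ⊆ M₁ ×ˢ nbhd Ls a m X₁ :=
    Set.prod_mono hM₂M (nbhd_mono hmono hX₂.1 a m)
  refine ⟨M₂, hM₂, (hM₂M.trans hM₁M).trans hM₀Q, X₂, hX₂Y, ?_⟩
  rcases hΨ₁ with h | h
  · refine Or.inl fun z hz => ?_
    -- A point of `Ψ c` outside the remainder `N c` lies in some `Ψ (c ++ [w])`; iterating from `[]`
    -- produces a branch.
    obtain ⟨c, hc0, hc⟩ := exists_seq_of_step (fun _ c => z ∈ Ψ c)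
      (fun _ c c' => ∃ w, c' = c ++ [w]) [] (h (hsub₁ hz)) (by
        intro _ c hzc
        by_contra hcon
        refine hN₃ z hz c ⟨hzc, fun hzU => ?_⟩
        obtain ⟨w, hw⟩ := Set.mem_iUnion.1 hzU
        exact hcon ⟨_, hw, w, rfl⟩)
    choose w hw using fun n => (hc n).2
    obtain ⟨A, hA⟩ := exists_wordSeq_of_branch c w hc0 hw fun n => by
      by_contra hcon
      have h := (hc n).1.2
      rw [hAR _ hcon] at h
      exact h
    refine Set.mem_iUnion.2 ⟨A, Set.mem_iInter.2 fun n => ?_⟩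
    rw [hA]
    exact (hc n).1.2
  · refine Or.inr fun z hz hzS => ?_
    rw [← souslinAt_nil] at hzS
    exact h (hsub₁ hz) (hsub [] z (hM₁M (hM₂M hz.1)) hzS)

/-! ### Translation between supports and located words -/

theorem comb_eq_ev (x : ℕ → List (Option L)) (F : Finset ℕ) (c : ℕ → Option L) :
    comb x F c = ev x ((F.sort (· ≤ ·)).map fun n => (n, c n)) := by
  simp [comb, ev, List.flatMap_map]

theorem exists_loc_of_comb {Ls : ℕ → Finset L} {F : Finset ℕ} (hF : F.Nonempty)
    {c : ℕ → Option L} (hc : ∀ n ∈ F, ∀ l, c n = some l → l ∈ Ls n) :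
    ∃ t, Loc Ls 0 t ∧ (∀ n, n ∈ F ↔ ∃ p ∈ t, p.1 = n) ∧
      ∀ x : ℕ → List (Option L), comb x F c = ev x t := by
  refine ⟨(F.sort (· ≤ ·)).map fun n => (n, c n), ⟨?_, ?_, ?_⟩, ?_, fun x => comb_eq_ev x F c⟩
  · obtain ⟨n, hn⟩ := hF
    exact List.ne_nil_of_mem (List.mem_map_of_mem ((Finset.mem_sort _).2 hn))
  · rw [List.pairwise_map]
    exact (Finset.sortedLT_sort F).pairwise
  · intro p hp
    obtain ⟨n, hn, rfl⟩ := List.mem_map.1 hp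
    exact ⟨Nat.zero_le _, hc n ((Finset.mem_sort _).1 hn)⟩
  · intro n
    simp

theorem exists_comb_of_loc {Ls : ℕ → Finset L} {m : ℕ} {t : List (ℕ × Option L)}
    (ht : Loc Ls m t) : ∃ (F : Finset ℕ) (c : ℕ → Option L), F.Nonempty ∧
      (∀ n, n ∈ F ↔ ∃ p ∈ t, p.1 = n) ∧ (∀ p ∈ t, c p.1 = p.2) ∧
      ∀ x : ℕ → List (Option L), comb x F c = ev x t := by
  obtain ⟨hne, hs, -⟩ := ht
  have hc : ∃ c : ℕ → Option L, ∀ p ∈ t, c p.1 = p.2 := by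
    clear hne
    induction t with
    | nil => exact ⟨fun _ => none, by simp⟩
    | cons q t ih =>
      obtain ⟨hq, hs⟩ := List.pairwise_cons.1 hs
      obtain ⟨c, hc⟩ := ih hs
      refine ⟨Function.update c q.1 q.2, fun p hp => ?_⟩
      rcases List.mem_cons.1 hp with rfl | hp
      · simp
      · rw [Function.update_of_ne (hq p hp).ne', hc p hp]
  obtain ⟨c, hc⟩ := hc
  have hmap : (t.map Prod.fst).Pairwise (· < ·) := by
    rw [List.pairwise_map]
    exact hs
  have hsort : (t.map Prod.fst).toFinset.sort (· ≤ ·) = t.map Prod.fst :=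
    (List.toFinset_sort (· ≤ ·) (hmap.imp fun h => h.ne)).2 (hmap.imp fun h => h.le)
  refine ⟨(t.map Prod.fst).toFinset, c, ?_, fun n => by simp, hc, fun x => ?_⟩
  · obtain ⟨p, hp⟩ := List.exists_mem_of_ne_nil _ hne
    exact ⟨p.1, List.mem_toFinset.2 (List.mem_map_of_mem hp)⟩
  · rw [comb_eq_ev, hsort, List.map_map]
    congr 1
    refine (List.map_congr_left fun p hp => ?_).trans (List.map_id t)
    simp [hc p hp]

theorem HasSuppL.exists_loc {Ls : ℕ → Finset L} {x : ℕ → List (Option L)} {F : Finset ℕ}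
    {w : List L} (h : HasSuppL Ls x F w) :
    ∃ t, Loc Ls 0 t ∧ (∀ n, n ∈ F ↔ ∃ p ∈ t, p.1 = n) ∧ w.map some = ev x t := by
  obtain ⟨hF, c, hc, hw⟩ := h
  obtain ⟨t, ht, hFt, htx⟩ := exists_loc_of_comb hF (c := fun n => some (c n)) (Ls := Ls)
    (by rintro n hn _ ⟨⟩; exact hc n hn)
  exact ⟨t, ht, hFt, hw.trans (htx x)⟩

theorem Loc.exists_hasSuppL {Ls : ℕ → Finset L} {x : ℕ → List (Option L)}
    {t : List (ℕ × Option L)} {w : List L} (ht : Loc Ls 0 t) (hn : ∀ p ∈ t, p.2 ≠ none)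
    (hw : w.map some = ev x t) :
    ∃ F, (∀ n, n ∈ F ↔ ∃ p ∈ t, p.1 = n) ∧ HasSuppL Ls x F w := by
  obtain ⟨F, c, hF, hFt, hc, htx⟩ := exists_comb_of_loc ht
  obtain ⟨p₀, hp₀⟩ := List.exists_mem_of_ne_nil _ ht.1
  -- `HasSuppL` asks for a letter at every index; `l₀` serves as the default outside the support.
  obtain ⟨l₀, -⟩ := Option.ne_none_iff_exists'.1 (hn p₀ hp₀)
  have hcF : ∀ n ∈ F, some ((c n).getD l₀) = c n := by
    intro n hnF
    obtain ⟨p, hp, rfl⟩ := (hFt n).1 hnF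
    obtain ⟨l, hl⟩ := Option.ne_none_iff_exists'.1 (hn p hp)
    rw [hc p hp, hl]
    rfl
  refine ⟨F, hFt, hF, fun n => (c n).getD l₀, fun n hnF => ?_, ?_⟩
  · obtain ⟨p, hp, rfl⟩ := (hFt n).1 hnF
    exact (ht.2.2 p hp).2 _ ((hc p hp).symm.trans (hcF _ hnF).symm)
  · rw [hw, ← htx x]
    exact List.flatMap_congr fun n hnF => 
      congrArg (subst (x n)) (hcF n ((Finset.mem_sort _).1 hnF)).symm

theorem varLE_iff {Ls : ℕ → Finset L} {X Y : VarWordSeq L} :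
    VarLE Ls X Y ↔ Blk Ls Y.1 0 X.1 := by
  constructor
  · rintro ⟨F, hF, hb⟩
    choose hne _ c hc hX using hF
    choose t ht hFt htx using fun n => exists_loc_of_comb (hne n) (hc n)
    exact ⟨t, fun n => ⟨ht n, (hX n).trans (htx n Y.1)⟩, fun n k hnk p hp q hq =>
      hb n k hnk _ ((hFt n _).2 ⟨p, hp, rfl⟩) _ ((hFt k _).2 ⟨q, hq, rfl⟩)⟩
  · rintro ⟨t, ht, hb⟩
    choose F c hne hFt hc htx using fun n => exists_comb_of_loc (ht n).1
    refine ⟨F, fun n => ⟨hne n, X.2.1 n, c n, fun k hk l hl => ?_, ?_⟩, ?_⟩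
    · obtain ⟨p, hp, rfl⟩ := (hFt n k).1 hk
      exact ((ht n).1.2.2 p hp).2 l ((hc n p hp).symm.trans hl)
    · rw [htx, (ht n).2]
    · intro n k hnk i hi j hj
      obtain ⟨p, hp, rfl⟩ := (hFt n i).1 hi
      obtain ⟨q, hq, rfl⟩ := (hFt k j).1 hj
      exact hb n k hnk p hp q hq

theorem wordLE_iff {Ls : ℕ → Finset L} {A : WordSeq L} {Y : VarWordSeq L} :
    WordLE Ls A Y ↔ Blk Ls Y.1 0 (fun n => (A.1 n).map some) := by
  constructor
  · rintro ⟨F, hF, hb⟩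
    choose t ht hFt htx using fun n => (hF n).exists_loc
    exact ⟨t, fun n => ⟨ht n, htx n⟩, fun n k hnk p hp q hq =>
      hb n k hnk _ ((hFt n _).2 ⟨p, hp, rfl⟩) _ ((hFt k _).2 ⟨q, hq, rfl⟩)⟩
  · rintro ⟨t, ht, hb⟩
    choose F hFt hF using fun n =>
      (ht n).1.exists_hasSuppL (ne_none_of_map_some_eq_ev (ht n).2) (ht n).2
    refine ⟨F, hF, ?_⟩
    intro n k hnk i hi j hj
    obtain ⟨p, hp, rfl⟩ := (hFt n i).1 hi
    obtain ⟨q, hq, rfl⟩ := (hFt k j).1 hj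
    exact hb n k hnk p hp q hq

theorem getD_s {Y : VarWordSeq L} {m n : ℕ} (h : n < m) : (s m Y).getD n [] = Y.1 n := by
  simp [s, List.getD, h]

theorem finWordLE_iff {Ls : ℕ → Finset L} {b : List (List L)} {Y : VarWordSeq L} {m : ℕ} :
    FinWordLE Ls b (s m Y) ↔ FBlk Ls Y.1 m b := by
  constructor
  · rintro ⟨F, hF, hb⟩
    have h : ∀ i, ∃ t, ∀ hi : i < b.length, Loc Ls 0 t ∧ (∀ n, n ∈ F i ↔ ∃ p ∈ t, p.1 = n) ∧
        b[i].map some = ev (fun n => (s m Y).getD n []) t := by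
      intro i
      by_cases hi : i < b.length
      · obtain ⟨t, ht⟩ := (hF i hi).2.exists_loc
        exact ⟨t, fun _ => ht⟩
      · exact ⟨[], fun h => absurd h hi⟩
    choose t ht using h
    have hlt : ∀ i, i < b.length → ∀ p ∈ t i, p.1 < m := by
      intro i hi p hp
      have := (hF i hi).1 (((ht i hi).2.1 p.1).2 ⟨p, hp, rfl⟩)
      simpa [s] using this
    refine ⟨t, fun i hi => ⟨(ht i hi).1, hlt i hi, ?_⟩, fun i j hij hj p hp q hq => ?_⟩
    · rw [(ht i hi).2.2]
      exact ev_congr fun p hp => getD_s (hlt i hi p hp)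
    · exact hb i j hij hj _ (((ht i (hij.trans hj)).2.1 _).2 ⟨p, hp, rfl⟩) _
        (((ht j hj).2.1 _).2 ⟨q, hq, rfl⟩)
  · rintro ⟨t, ht, hb⟩
    have h : ∀ i, ∃ F, ∀ hi : i < b.length, (∀ n, n ∈ F ↔ ∃ p ∈ t i, p.1 = n) ∧
        HasSuppL Ls (fun n => (s m Y).getD n []) F b[i] := by
      intro i
      by_cases hi : i < b.length
      · obtain ⟨h1, h2, h3⟩ := ht i hi
        obtain ⟨F, hF⟩ := h1.exists_hasSuppL (ne_none_of_map_some_eq_ev h3)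
          (h3.trans (ev_congr (z := fun n => (s m Y).getD n [])
            fun p hp => (getD_s (h2 p hp)).symm))
        exact ⟨F, fun _ => hF⟩
      · exact ⟨∅, fun h => absurd h hi⟩
    choose F hF using h
    refine ⟨F, fun i hi => ⟨fun n hn => ?_, (hF i hi).2⟩, fun i j hij hj n hn k hk => ?_⟩
    · obtain ⟨p, hp, rfl⟩ := ((hF i hi).1 n).1 hn
      simpa [s] using (ht i hi).2.1 p hp
    · obtain ⟨p, hp, rfl⟩ := ((hF i (hij.trans hj)).1 n).1 hn
      obtain ⟨q, hq, rfl⟩ := ((hF j hj).1 k).1 hk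
      exact hb i j hij hj p hp q hq

theorem mem_basic_iff {Ls : ℕ → Finset L} {a : List (List L)} {Y : VarWordSeq L}
    {A : WordSeq L} : A ∈ basic Ls a Y ↔
      Blk Ls Y.1 0 (fun n => (A.1 n).map some) ∧ r a.length A = a := by
  rw [basic, Set.mem_ofPred_eq, wordLE_iff]
  refine and_congr_right fun _ => ⟨?_, fun h => ⟨_, h⟩⟩
  rintro ⟨n, rfl⟩
  rw [length_r]

theorem mem_depthNhd_iff {Ls : ℕ → Finset L} {a : List (List L)} {X Y : VarWordSeq L} {d : ℕ}
    (hd : FBlk Ls Y.1 d a) (hmin : ∀ k < d, ¬ FBlk Ls Y.1 k a) :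
    X ∈ depthNhd Ls a Y ↔ Ext Ls d X Y := by
  classical
  have hex : ∃ k, FinWordLE Ls a (s k Y) := ⟨d, finWordLE_iff.2 hd⟩
  have hdepth : depth Ls Y a = d := by
    rw [depth, dif_pos hex]
    norm_cast
    rw [Nat.find_eq_iff]
    exact ⟨finWordLE_iff.2 hd, fun k hk h => hmin k hk (finWordLE_iff.1 h)⟩
  rw [depthNhd, Set.mem_ofPred_eq, hdepth]
  simp only [Nat.cast_inj, exists_eq_left, basicVar, Set.mem_ofPred_eq, varLE_iff]
  refine and_congr_right fun _ => ⟨?_, fun h => ⟨d, ?_⟩⟩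
  · rintro ⟨n, hn⟩ i hi
    have hnd : n = d := by
      have := congrArg List.length hn
      simpa [s] using this
    subst hnd
    rw [s, s, List.map_inj_left] at hn
    exact hn i (List.mem_range.2 hi)
  · rw [s, s, List.map_inj_left]
    exact fun i hi => h i (List.mem_range.1 hi)

theorem getElem_eq_of_r {a : List (List L)} {A : WordSeq L} (h : r a.length A = a) {i : ℕ}
    (hi : i < a.length) : a[i] = A.1 i := by
  have : a[i] = (r a.length A)[i]'(by rwa [length_r]) := by simp only [h]
  rw [this]
  simp [r]

theorem nbhd_subset_basic {Ls : ℕ → Finset L} {a : List (List L)} {X : VarWordSeq L} {m : ℕ}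
    (ha : FBlk Ls X.1 m a) : nbhd Ls a m X ⊆ basic Ls a X := by
  rintro A ⟨hr, σ, hσ, hσb⟩
  obtain ⟨τ, hτ, hτb⟩ := ha
  refine mem_basic_iff.2 ⟨⟨fun n => if n < a.length then τ n else σ (n - a.length),
    fun n => ?_, fun n k hnk p hp q hq => ?_⟩, hr⟩
  · by_cases hn : n < a.length
    · simp only [hn, if_true]
      exact ⟨(hτ n hn).1, by rw [← (hτ n hn).2.2, getElem_eq_of_r hr hn]⟩
    · simp only [hn, if_false]
      refine ⟨(hσ _).1.mono (Nat.zero_le _), ?_⟩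
      rw [← (hσ _).2]
      exact congrArg (fun i => (A.1 i).map some) (by omega)
  · dsimp only at hp hq
    split_ifs at hp hq with h1 h2 h2
    · exact hτb n k hnk h2 p hp q hq
    · exact ((hτ n h1).2.1 p hp).trans_le ((hσ _).1.2.2 q hq).1
    · omega
    · exact hσb _ _ (by omega) p hp q hq

/-- If a term after `a` used an index below `d`, then `a` would be located before that index,
against the minimality of `d`. -/
theorem basic_subset_nbhd {Ls : ℕ → Finset L} {a : List (List L)} {X : VarWordSeq L} {d : ℕ}
    (hmin : ∀ k < d, ¬ FBlk Ls X.1 k a) : basic Ls a X ⊆ nbhd Ls a d X := by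
  intro A hA
  obtain ⟨⟨τ, hτ, hb⟩, hr⟩ := mem_basic_iff.1 hA
  refine ⟨hr, fun n => τ (a.length + n), fun n => ⟨⟨(hτ _).1.1, (hτ _).1.2.1, fun p hp =>
    ⟨?_, ((hτ _).1.2.2 p hp).2⟩⟩, (hτ _).2⟩, fun n k hnk => hb _ _ (by omega)⟩
  by_contra hlt
  refine hmin p.1 (not_le.1 hlt) ⟨τ, fun i hi => ⟨(hτ i).1, fun q hq =>
    hb _ _ (by omega) q hq p hp, ?_⟩, fun i j hij _ => hb i j hij⟩
  rw [getElem_eq_of_r hr hi]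
  exact (hτ i).2

theorem exists_fblk_of_mem_basic {Ls : ℕ → Finset L} {a : List (List L)} {Y : VarWordSeq L}
    {A : WordSeq L} (hA : A ∈ basic Ls a Y) : ∃ k, FBlk Ls Y.1 k a := by
  obtain ⟨⟨τ, hτ, hb⟩, hr⟩ := mem_basic_iff.1 hA
  obtain ⟨p, hp⟩ := List.exists_mem_of_ne_nil _ (hτ a.length).1.1
  refine ⟨p.1, τ, fun i hi => ⟨(hτ i).1, fun q hq => hb _ _ hi q hq p hp, ?_⟩,
    fun i j hij _ => hb i j hij⟩
  rw [getElem_eq_of_r hr hi]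
  exact (hτ i).2

/-- Past `a`, terms of `X` are evaluated at a fixed letter, starting from index `m + n₀`, where that
letter is allowed. -/
theorem basic_nonempty {Ls : ℕ → Finset L} (hmono : Monotone Ls)
    (hunion : ∀ l : L, ∃ n, l ∈ Ls n) [Nonempty L] {a : List (List L)} {X : VarWordSeq L} {m : ℕ}
    (ha : FBlk Ls X.1 m a) : (basic Ls a X).Nonempty := by
  obtain ⟨τ, hτ, hτb⟩ := ha
  obtain ⟨l⟩ := ‹Nonempty L›
  obtain ⟨n₀, hn₀⟩ := hunion l
  let B : ℕ → List L := fun n =>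
    if hn : n < a.length then a[n] else (X.1 (m + n₀ + n)).map fun d => d.getD l
  have hB : Blk Ls X.1 0 (fun n => (B n).map some) := by
    refine ⟨fun n => if n < a.length then τ n else [(m + n₀ + n, some l)], fun n => ?_,
      fun n k hnk p hp q hq => ?_⟩
    · by_cases hn : n < a.length
      · simp only [B, hn, if_true, dif_pos]
        exact ⟨(hτ n hn).1, (hτ n hn).2.2⟩
      · simp only [B, hn, if_false, dif_neg, not_false_eq_true]
        refine ⟨⟨by simp, by simp, ?_⟩, ?_⟩
        · simp only [List.mem_singleton, forall_eq, Option.some.injEq]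
          exact ⟨Nat.zero_le _, fun l' hl' => hmono (show n₀ ≤ m + n₀ + n by omega) (hl' ▸ hn₀)⟩
        · rw [ev_singleton, subst, List.map_map]
          refine List.map_congr_left fun d _ => ?_
          cases d <;> rfl
    · dsimp only at hp hq
      split_ifs at hp hq with h1 h2 h2
      · exact hτb n k hnk h2 p hp q hq
      · rw [List.mem_singleton] at hq
        subst hq
        have := (hτ n h1).2.1 p hp
        dsimp only
        omega
      · omega
      · rw [List.mem_singleton] at hp hq
        subst hp hq
        dsimp only
        omega
  have hBr : RapidlyIncreasing B := by
    have h := hB.rapidlyIncreasing X.2.2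
    simpa [RapidlyIncreasing] using h
  refine ⟨⟨B, hBr⟩, mem_basic_iff.2 ⟨hB, ?_⟩⟩
  refine List.ext_getElem (by simp [r]) fun i h1 h2 => ?_
  simp [r, B, h2]

/-- At the minimal cut, which is the depth, `basic` lies inside `nbhd`. At a larger cut `j`, the
refinement given by `IsPerfectlyRamsey` fixes only the terms below the depth, and `exists_ext_nbhd`
makes it fix `j` terms. -/
theorem isPerfectlyRamsey_iff {Ls : ℕ → Finset L} (hmono : Monotone Ls)
    (hunion : ∀ l : L, ∃ n, l ∈ Ls n) [Nonempty L] {Lam : Set ((ℕ → Bool) × WordSeq L)} :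
    IsPerfectlyRamsey Ls Lam ↔ ∀ M X, RamBelow Ls M X Lam := by
  classical
  constructor
  · intro h _ _ M hM _ X _ b j hb
    rcases (nbhd Ls b j X).eq_empty_or_nonempty with he | ⟨A, hA⟩
    · exact ⟨M, hM, subset_rfl, X, Ext.refl _ _ _, Or.inl (by simp [he])⟩
    have hex : ∃ k, FBlk Ls X.1 k b := ⟨j, hb⟩
    obtain ⟨M', hM', hM'M, X', hX', -, hd⟩ := h M hM b ⟨A, _, hA.1⟩ X
      ⟨A, nbhd_subset_basic hb hA⟩
    rw [mem_depthNhd_iff (Nat.find_spec hex) fun k hk => Nat.find_min hex hk] at hX'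
    obtain ⟨X'', hX'', hsub⟩ := exists_ext_nbhd hmono hX'.1 j j
    have hsub' : M' ×ˢ nbhd Ls b j X'' ⊆ M' ×ˢ basic Ls b X' :=
      Set.prod_mono subset_rfl ((hsub b).trans (nbhd_subset_basic
        (((Nat.find_spec hex).congr fun n hn => (hX'.2 n hn).symm).mono
          (Nat.find_min' hex hb))))
    exact ⟨M', hM', hM'M, X'', hX'', hd.imp hsub'.trans hsub'.trans⟩
  · rintro h Q hQ a - Y ⟨A, hA⟩
    have hex := exists_fblk_of_mem_basic hA
    have hspec := Nat.find_spec hex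
    have hmin : ∀ k < Nat.find hex, ¬ FBlk Ls Y.1 k a := fun k hk => Nat.find_min hex hk
    obtain ⟨M, hM, hMQ, X, hX, hd⟩ :=
      h Q Y Q hQ subset_rfl Y (Blk.refl _ _) a (Nat.find hex) hspec
    have hsub : M ×ˢ basic Ls a X ⊆ M ×ˢ nbhd Ls a (Nat.find hex) X :=
      Set.prod_mono subset_rfl (basic_subset_nbhd fun k hk hk' =>
        hmin k hk (hk'.congr fun n hn => hX.2 n (hn.trans hk)))
    exact ⟨M, hM, hMQ, X, (mem_depthNhd_iff hspec hmin).2 hX,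
      basic_nonempty hmono hunion (hspec.congr fun n hn => (hX.2 n hn).symm),
      hd.imp hsub.trans hsub.trans⟩

theorem isEmpty_wordSeq [IsEmpty L] : IsEmpty (WordSeq L) := by
  refine ⟨fun A => ?_⟩
  have h := A.2 0
  cases hw : A.1 0 with
  | nil => simp [hw] at h
  | cons l w => exact isEmptyElim l

end HJ

theorem mainTheorem7 {L : Type*} (Ls : ℕ → Finset L) (hmono : Monotone Ls)
    (hunion : ∀ l : L, ∃ n, l ∈ Ls n) :
    MeasureTheory.IsSetAlgebra
      {Lam : Set ((ℕ → Bool) × HJ.WordSeq L) | HJ.IsPerfectlyRamsey Ls Lam} ∧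
    ∀ Lam : List (List L) → Set ((ℕ → Bool) × HJ.WordSeq L),
      (∀ a ∈ HJ.AR L, HJ.IsPerfectlyRamsey Ls (Lam a)) →
        HJ.IsPerfectlyRamsey Ls (HJ.souslin Lam) := by
  classical
  rcases isEmpty_or_nonempty L with hL | hL
  -- Over an empty alphabet there are no rapidly increasing sequences, since their words are
  -- nonempty; every set is then vacuously Ramsey.
  · have := HJ.isEmpty_wordSeq (L := L)
    have h : ∀ Lam, HJ.IsPerfectlyRamsey Ls Lam := by
      rintro Lam Q - a ⟨A, -⟩
      exact isEmptyElim A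
    exact ⟨⟨h _, fun _ _ => h _, fun _ _ _ _ => h _⟩, fun _ _ => h _⟩
  · simp only [HJ.isPerfectlyRamsey_iff hmono hunion]
    refine ⟨⟨?_, fun S hS M X => (hS M X).compl,
      fun S T hS hT M X => HJ.RamBelow.union hmono hunion (hS M X) (hT M X)⟩, fun Lam hLam => ?_⟩
    · rintro _ _ M hM _ X _ b j _
      exact ⟨M, hM, subset_rfl, X, HJ.Ext.refl _ _ _, Or.inr (by simp)⟩
    · intro M X
      -- Values of `Lam` outside `AR L` never enter the operation. Making them empty gives Ramsey
      -- sets at all indices and forces branches to stay in `AR L`.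
      have hS : HJ.souslin Lam =
          HJ.souslin fun c => if c ∈ HJ.AR L then Lam c else ∅ := by
        have : ∀ (A : HJ.WordSeq L) n, HJ.r n A ∈ HJ.AR L := fun A n => ⟨A, n, rfl⟩
        simp [HJ.souslin, this]
      rw [hS]
      refine HJ.ramBelow_souslin hmono hunion (fun c M X => ?_) (fun c hc => if_neg hc) M X
      by_cases hc : c ∈ HJ.AR L
      · simpa only [hc, if_true] using hLam c hc M X
      · simp only [hc, if_false]
        intro M hM _ X _ b j _
        exact ⟨M, hM, subset_rfl, X, HJ.Ext.refl _ _ _, Or.inr (by simp)⟩
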